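/- Let $\Gamma$ be a finitely generated group. A \emph{locally checkable labeling (LCL) problem} on $\Gamma$ is a triple $\Pi=(W,\Lambda,\mathcal A)$, where $W\subseteq\Gamma$ is a finite set, $\Lambda$ is a finite set of labels, and $\mathcal A\subseteq\Lambda^W$. A \emph{solution} to $\Pi$ on an action $\Gamma\curvearrowright X$ is a function $f\colon X\to\Lambda$ such that for every $x\in X$ the map $W\to\Lambda$, $w\mapsto f(w\cdot x)$, belongs to $\mathcal A$. If $X$ is a topological space, $f$ is \emph{Baire-measurable} if $f^{-1}(\lambda)$ has the Baire property for every $\lambda\in\Lambda$. Let $\mathtt{BAIRE}(\Gamma)$ be the class of all LCL problems on $\Gamma$ that have a Baire-measurable solution on $X$ for every free Borel action $\Gamma\curvearrowright X$ on a Polish space $X$. Let $\mathcal F(2,\Gamma)$ be the set of all $x\in\{0,1\}^\Gamma$ such that $\gamma\cdot x\neq x$ for all $\gamma\in\Gamma\setminus\{\mathbf 1\}$, where $(\gamma\cdot x)(\delta)=x(\delta\gamma)$ is the shift action; it is given the subspace topology of the product topology on $\{0,1\}^\Gamma$ (with $\{0,1\}$ discrete) and the shift action of $\Gamma$. Let $\mathtt{BaireSHIFT}(\Gamma)$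 be the class of all LCL problems on $\Gamma$ that have a Baire-measurable solution on $\mathcal F(2,\Gamma)$. \textbf{Theorem.} For every integer $n\geq 2$, \[\mathtt{BAIRE}(\mathbb Z^n)\subsetneq\mathtt{BaireSHIFT}(\mathbb Z^n).\] That is, every LCL problem in $\mathtt{BAIRE}(\mathbb Z^n)$ is in $\mathtt{BaireSHIFT}(\mathbb Z^n)$, and some LCL problem on $\mathbb Z^n$ has a Baire-measurable solution on $\mathcal F(2,\mathbb Z^n)$ but has no Baire-measurable solution on some free Borel action of $\mathbb Z^n$ on a Polish space; so the shift action on $\mathcal F(2,\mathbb Z^n)$ is not universal for Baire-measurable solutions of LCL problems. -/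

import Mathlib

/-! Locally checkable labeling problems on a group `Γ` (written additively, since the group of
interest is `ℤⁿ`), Baire-measurable solutions on actions of `Γ`, and the free part of the shift. -/

universe u v w

/-- A locally checkable labeling problem `(W, Λ, 𝒜)` on the group `Γ`: a finite window `W ⊆ Γ`,
a finite set `Λ` of labels, and a set `𝒜 ⊆ Λ^W` of allowed configurations. -/
structure LCLProblem (Γ : Type w) where
  /-- the window `W` -/
  window : Finset Γ
  /-- the set `Λ` of labels -/
  Label : Type v
  finite_label : Finite Label
  /-- the set `𝒜` of allowed configurations -/
  allowed : Set (window → Label)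

/-- `f : X → Λ` solves `P` on the action of `Γ` on `X`: for every `x`, the configuration
`w ↦ f (w · x)` on the window is allowed. -/
def LCLProblem.IsSolution {Γ : Type w} [AddGroup Γ] (P : LCLProblem.{v, w} Γ)
    {X : Type u} [AddAction Γ X] (f : X → P.Label) : Prop :=
  ∀ x : X, (fun γ : P.window => f ((γ : Γ) +ᵥ x)) ∈ P.allowed

/-- Baire measurability of a map to a discrete space: every set of labels has a preimage with the
Baire property. -/
def IsBaireMeasurableLabeling {X : Type u} [TopologicalSpace X] {L : Type v} (f : X → L) : Prop :=
  ∀ s : Set L, BaireMeasurableSet (f ⁻¹' s)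

/-- The action of `Γ` on `X` is free. -/
def IsFreeAction (Γ : Type w) [AddGroup Γ] (X : Type u) [AddAction Γ X] : Prop :=
  ∀ γ : Γ, γ ≠ 0 → ∀ x : X, γ +ᵥ x ≠ x

/-- The action of the (countable, discrete) group `Γ` on the topological space `X` is Borel. -/
def IsBorelAction (Γ : Type w) [AddGroup Γ] (X : Type u) [TopologicalSpace X]
    [AddAction Γ X] : Prop :=
  ∀ γ : Γ, @Measurable X X (borel X) (borel X) (fun x : X => γ +ᵥ x)

/-- The class `BAIRE(Γ)`: problems with a Baire-measurable solution on every free Borel action of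
`Γ` on a Polish space. -/
def BAIRE (Γ : Type w) [AddGroup Γ] : Set (LCLProblem.{v, w} Γ) :=
  {P | ∀ (X : Type u) [TopologicalSpace X] [PolishSpace X] [AddAction Γ X],
    IsBorelAction Γ X → IsFreeAction Γ X →
      ∃ f : X → P.Label, P.IsSolution f ∧ IsBaireMeasurableLabeling f}

/-- The shift of a function `x : Γ → X`: `(γ · x) δ = x (δ + γ)`. -/
def shift {Γ : Type w} [AddGroup Γ] {X : Type u} (γ : Γ) (x : Γ → X) : Γ → X :=
  fun δ => x (δ + γ)

/-- The free part `𝓕(X, Γ)` of the shift action on `X^Γ`. As a subtype of `Γ → X` it carries the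
subspace topology of the product topology. -/
def freePart (X : Type u) (Γ : Type w) [AddGroup Γ] : Set (Γ → X) :=
  {x | ∀ γ : Γ, γ ≠ 0 → shift γ x ≠ x}

theorem shift_zero {Γ : Type w} [AddGroup Γ] {X : Type u} (x : Γ → X) : shift 0 x = x := by
  funext δ
  simp [shift]

theorem shift_add {Γ : Type w} [AddGroup Γ] {X : Type u} (γ δ : Γ) (x : Γ → X) :
    shift (γ + δ) x = shift γ (shift δ x) := by
  funext ε
  simp [shift, add_assoc]

theorem shift_mem_freePart {Γ : Type w} [AddGroup Γ] {X : Type u} (δ : Γ) {x : Γ → X}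
    (hx : x ∈ freePart X Γ) : shift δ x ∈ freePart X Γ := by
  intro γ hγ h
  refine hx (-δ + γ + δ) (fun h0 => hγ ?_) ?_
  · have h1 : γ = δ + (-δ + γ + δ) + -δ := by simp [add_assoc]
    rw [h1, h0]
    simp
  · rw [shift_add, shift_add, h, ← shift_add, neg_add_cancel, shift_zero]

/-- The shift action of `Γ` on the free part. -/
instance freePartAddAction (X : Type u) (Γ : Type w) [AddGroup Γ] :
    AddAction Γ (freePart X Γ) where
  vadd γ x := ⟨shift γ x.1, shift_mem_freePart γ x.2⟩
  zero_vadd x := Subtype.ext (shift_zero x.1)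
  add_vadd γ δ x := Subtype.ext (shift_add γ δ x.1)

/-- The class `BaireSHIFT(Γ)`: problems with a Baire-measurable solution on `𝓕(2, Γ)`, where the
two-point set `2 = {0, 1}` is discrete. -/
def BaireSHIFT (Γ : Type w) [AddGroup Γ] : Set (LCLProblem.{v, w} Γ) :=
  {P | ∃ f : freePart (Fin 2) Γ → P.Label, P.IsSolution f ∧ IsBaireMeasurableLabeling f}

/-! The separating problem asks for a labeling of planes by nested boxes with triangular buffers as
large as the boxes, and a two-coloring that may change phase only across walls of boxes. Generic
points of the shift contain isolated boxes of all sizes and so have such labelings. On the triadic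
odometer every label recurs along a lattice of odd index step, hence the buffers, and with them the
boxes, have bounded size; the coloring then continues around every box, contradicting parity. -/

/-! ### The labeling problem -/

/-! Inclusion: the free part of the shift is an intersection of countably many open sets in a Polish
space, hence itself Polish (`polishSpace_freePart`), so it is one of the actions over which `BAIRE`
quantifies. Strictness is witnessed by `nestedBoxProblem`, a rule on the planes of the first two
coordinates.

The problem is solvable on the shift. For a comeagre set of patterns every cell lies in an isolated
box: a frame of ones surrounded by zeros up to four side lengths. The collars of different isolated
boxes do not touch (`IsBox.eq_of_near`), so each box can carry its own buffers, and the color is the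
parity of the position in the smallest box around the cell (`isConfiguration_patternLabel`). The
remaining meagre invariant set is colored by choice.

It is not solvable on the translation action on `ℤ_[3]ⁿ`. A Baire-measurable solution agrees with an
open condition along a generic orbit, so each label recurs along a lattice of step `3 ^ k`, which is
odd. No configuration does this (`not_oddlyRecurrent`). A long wall would force a large triangular
buffer, which meets the lattice of a recurring `sea` cell; hence boxes are bounded. A box met in a
row can then be bypassed through its buffers, where the color alternates, so the color relative to
the checkerboard is the same at all cells of the row outside boxes. Two such cells at odd distance
with equal labels give a contradiction. -/

/-- The marks of the labeling problem: a cell is plain `sea`, or lies in the northern, eastern,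
southern or western buffer of a box. -/
inductive Mark
  | sea
  | north
  | east
  | south
  | west
  deriving DecidableEq

instance : Fintype Mark :=
  ⟨{.sea, .north, .east, .south, .west}, fun x => by cases x <;> simp⟩

/-- The change of nesting depth along a horizontal edge: `1` when a box is entered through its
western wall, `-1` when it is left through its eastern wall. -/
def hstep : Mark → Mark → ℤ
  | .west, .sea => 1
  | .sea, .east => -1
  | _, _ => 0

/-- The change of nesting depth along a vertical edge. -/
def vstep : Mark → Mark → ℤ
  | .south, .sea => 1
  | .sea, .north => -1
  | _, _ => 0

/-- The local rule on a two by two window with corners `p` (lower left), `q` (lower right),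
`r` (upper left), `s` (upper right): the depth change around the window vanishes, the northern,
western and eastern buffers shrink by at most one cell per layer, and the color alternates across
edges that do not cross a wall. -/
def LocalRule (p q r s : Mark × ZMod 2) : Prop :=
  hstep p.1 q.1 + vstep q.1 s.1 = vstep p.1 r.1 + hstep r.1 s.1 ∧
  (p.1 = .north → q.1 = .north → r.1 = .north) ∧
  (q.1 = .west → s.1 = .west → p.1 = .west) ∧
  (p.1 = .east → r.1 = .east → q.1 = .east) ∧
  (hstep p.1 q.1 = 0 → q.2 = p.2 + 1) ∧
  (vstep p.1 r.1 = 0 → r.2 = p.2 + 1)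

/-- A labeling of the plane `ℤ²` that satisfies the local rule everywhere. -/
def IsConfiguration (f : ℤ → ℤ → Mark × ZMod 2) : Prop :=
  ∀ x y, LocalRule (f x y) (f (x + 1) y) (f x (y + 1)) (f (x + 1) (y + 1))

/-! ### Potentials and runs on the integers -/

theorem exists_primitive (h : ℤ → ℤ) : ∃ F : ℤ → ℤ, F 0 = 0 ∧ ∀ x, F (x + 1) = F x + h x := by
  refine ⟨fun n => match n with
    | .ofNat n => ∑ i ∈ Finset.range n, h i
    | .negSucc n => -∑ i ∈ Finset.range (n + 1), h (-(i + 1 : ℤ)), by simp, ?_⟩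
  intro x
  match x with
  | .ofNat n => exact Finset.sum_range_succ (fun i : ℕ => h i) n
  | .negSucc 0 => simp
  | .negSucc (n + 1) =>
    have : Int.negSucc (n + 1) + 1 = Int.negSucc n := by omega
    rw [this]
    simp only
    rw [Finset.sum_range_succ _ (n + 1)]
    have : -((↑(n + 1) : ℤ) + 1) = Int.negSucc (n + 1) := by omega
    rw [this]
    ring

/-- Discrete Poincaré lemma: increments that cancel around every unit square have a potential.
Applied to `hstep` and `vstep` it yields the nesting depth. -/
theorem exists_potential (h v : ℤ → ℤ → ℤ)
    (curl : ∀ x y, h x y + v (x + 1) y = v x y + h x (y + 1)) :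
    ∃ D : ℤ → ℤ → ℤ, (∀ x y, D (x + 1) y = D x y + h x y) ∧
      ∀ x y, D x (y + 1) = D x y + v x y := by
  obtain ⟨V, -, hV⟩ := exists_primitive (v 0)
  choose H hH0 hH using fun y => exists_primitive (fun x => h x y)
  refine ⟨fun x y => V y + H y x, fun x y => by simp only [hH]; ring, fun x y => ?_⟩
  induction x using Int.induction_on with
  | zero => simp only [hH0, hV]; ring
  | succ i ih => simp only [hH] at ih ⊢; linarith [curl i y]
  | pred i ih =>
    have h1 := hH y (-i - 1)
    have h2 := hH (y + 1) (-i - 1)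
    have h3 := curl (-i - 1) y
    simp only [sub_add_cancel] at h1 h2 h3
    linarith

/-- Used to follow a wall until its corner: `P` says that the wall is present, `Q` that it turns. -/
theorem exists_run_up {P Q : ℤ → Prop} {y : ℤ} (h0 : P y) (hs : ∀ j, P j → P (j + 1) ∨ Q j)
    (hn : ¬ ∀ j, y ≤ j → P j) : ∃ t, y ≤ t ∧ (∀ j, y ≤ j → j ≤ t → P j) ∧ Q t := by
  by_contra hc
  push Not at hc
  apply hn
  have key : ∀ t, y ≤ t → ∀ j, y ≤ j → j ≤ t → P j := by
    intro t ht
    induction t, ht using Int.leInduction with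
    | base => intro j h1 h2; rwa [le_antisymm h2 h1]
    | succ t ht ih =>
      intro j h1 h2
      rcases h2.lt_or_eq with h2 | rfl
      · exact ih j h1 (by omega)
      · exact (hs t (ih t ht le_rfl)).resolve_right (hc t ht ih)
  exact fun j hj => key j hj j hj le_rfl

theorem exists_run_down {P Q : ℤ → Prop} {y : ℤ} (h0 : P y) (hs : ∀ j, P j → P (j - 1) ∨ Q j)
    (hn : ¬ ∀ j, j ≤ y → P j) : ∃ t, t ≤ y ∧ (∀ j, t ≤ j → j ≤ y → P j) ∧ Q t := by
  obtain ⟨t, ht, h1, h2⟩ := exists_run_up (P := fun j => P (-j)) (Q := fun j => Q (-j)) (y := -y)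
    (by simpa using h0) (fun j hj => by
      rw [neg_add, ← sub_eq_add_neg]; exact hs (-j) hj)
    (fun h => hn fun j hj => by simpa using h (-j) (by omega))
  exact ⟨-t, by omega, fun j h3 h4 => by simpa using h1 (-j) (by omega) (by omega), h2⟩

/-! ### Walls of a configuration -/

section Walls

theorem hstep_west_sea {p q : Mark} (h : p = .west) (h' : q = .sea) : hstep p q = 1 := by
  subst h h'; rfl

theorem hstep_sea_east {p q : Mark} (h : p = .sea) (h' : q = .east) : hstep p q = -1 := by
  subst h h'; rfl

theorem hstep_sea_sea {p q : Mark} (h : p = .sea) (h' : q = .sea) : hstep p q = 0 := by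
  subst h h'; rfl

theorem hstep_eq_zero {p q : Mark} (h₁ : ¬ (p = .west ∧ q = .sea)) (h₂ : ¬ (p = .sea ∧ q = .east)) :
    hstep p q = 0 := by
  revert p q; decide

theorem vstep_eq_zero {p q : Mark} (h₁ : ¬ (p = .south ∧ q = .sea))
    (h₂ : ¬ (p = .sea ∧ q = .north)) : vstep p q = 0 := by
  revert p q; decide

variable {p q r s : Mark}

/-- In this and the next seven lemmas the depth change around a window vanishes, so a wall that
enters the window must leave it. It continues straight or turns at a corner, and the mark named in
the second alternative identifies the turn. -/
theorem north_wall_right : hstep p q + vstep q s = vstep p r + hstep r s → p = .sea → r = .north →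
    (q = .sea ∧ s = .north) ∨ q = .east := by
  revert p q r s; decide

theorem north_wall_left : hstep p q + vstep q s = vstep p r + hstep r s → q = .sea → s = .north →
    (p = .sea ∧ r = .north) ∨ p = .west := by
  revert p q r s; decide

theorem south_wall_right : hstep p q + vstep q s = vstep p r + hstep r s → p = .south → r = .sea →
    (q = .south ∧ s = .sea) ∨ s = .east := by
  revert p q r s; decide

theorem south_wall_left : hstep p q + vstep q s = vstep p r + hstep r s → q = .south → s = .sea →
    (p = .south ∧ r = .sea) ∨ r = .west := by
  revert p q r s; decide

theorem west_wall_up : hstep p q + vstep q s = vstep p r + hstep r s → p = .west → q = .sea →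
    (r = .west ∧ s = .sea) ∨ s = .north := by
  revert p q r s; decide

theorem west_wall_down : hstep p q + vstep q s = vstep p r + hstep r s → r = .west → s = .sea →
    (p = .west ∧ q = .sea) ∨ q = .south := by
  revert p q r s; decide

theorem east_wall_up : hstep p q + vstep q s = vstep p r + hstep r s → p = .sea → q = .east →
    (r = .sea ∧ s = .east) ∨ r = .north := by
  revert p q r s; decide

theorem east_wall_down : hstep p q + vstep q s = vstep p r + hstep r s → r = .sea → s = .east →
    (p = .sea ∧ q = .east) ∨ p = .south := by
  revert p q r s; decide

end Walls

/-! ### Configurations in which every pattern recurs along an odd lattice -/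

namespace IsConfiguration

variable {f : ℤ → ℤ → Mark × ZMod 2} (hf : IsConfiguration f)

include hf

theorem curl (x y : ℤ) : hstep (f x y).1 (f (x + 1) y).1 + vstep (f (x + 1) y).1 (f (x + 1) (y + 1)).1
    = vstep (f x y).1 (f x (y + 1)).1 + hstep (f x (y + 1)).1 (f (x + 1) (y + 1)).1 :=
  (hf x y).1

theorem north_triangle {a b y : ℤ} (h : ∀ x, a ≤ x → x ≤ b → (f x y).1 = .north) (j : ℕ) :
    ∀ x, a ≤ x → x ≤ b - j → (f x (y + j)).1 = .north := by
  induction j with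
  | zero => simpa using h
  | succ j ih =>
    intro x h1 h2
    push_cast at h2 ⊢
    rw [← add_assoc]
    exact (hf x (y + j)).2.1 (ih x h1 (by omega)) (ih (x + 1) (by omega) (by omega))

theorem west_triangle {a b x : ℤ} (h : ∀ y, a ≤ y → y ≤ b → (f x y).1 = .west) (j : ℕ) :
    ∀ y, a ≤ y → y ≤ b - j → (f (x - j) y).1 = .west := by
  induction j with
  | zero => simpa using h
  | succ j ih =>
    intro y h1 h2
    push_cast at h2 ⊢
    have := (hf (x - (j + 1)) y).2.2.1
    rw [show x - (j + 1) + 1 = x - (j : ℤ) by ring] at this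
    exact this (ih y h1 (by omega)) (ih (y + 1) (by omega) (by omega))

theorem east_triangle {a b x : ℤ} (h : ∀ y, a ≤ y → y ≤ b → (f x y).1 = .east) (j : ℕ) :
    ∀ y, a ≤ y → y ≤ b - j → (f (x + j) y).1 = .east := by
  induction j with
  | zero => simpa using h
  | succ j ih =>
    intro y h1 h2
    push_cast at h2 ⊢
    rw [← add_assoc]
    exact (hf (x + j) y).2.2.2.1 (ih y h1 (by omega)) (ih (y + 1) (by omega) (by omega))

omit hf in
theorem _root_.exists_lattice_point {m : ℤ} (hm : 0 < m) (x₀ a : ℤ) :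
    ∃ i, a ≤ x₀ + m * i ∧ x₀ + m * i < a + m := by
  refine ⟨-((x₀ - a) / m), ?_⟩
  have h1 := Int.emod_nonneg (x₀ - a) hm.ne'
  have h2 := Int.emod_lt_of_pos (x₀ - a) hm
  have h3 := Int.emod_add_mul_ediv (x₀ - a) m
  constructor <;> linarith

/-! ### Recurrence bounds the length of walls. -/

section Bounds

variable {m x₀ y₀ : ℤ} (hm : 0 < m) (hs : ∀ i j, (f (x₀ + m * i) (y₀ + m * j)).1 = .sea)

include hm hs

/-- A run of length `2 * m` carries a triangle that contains an `m` by `m` square, and such a square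
meets the lattice of `sea` cells. -/
theorem north_run_lt {a b y : ℤ} (h : ∀ x, a ≤ x → x ≤ b → (f x y).1 = .north) :
    b - a < 2 * m := by
  by_contra hc
  obtain ⟨i, hi1, hi2⟩ := exists_lattice_point hm x₀ a
  obtain ⟨j, hj1, hj2⟩ := exists_lattice_point hm y₀ y
  obtain ⟨k, hk⟩ := Int.eq_ofNat_of_zero_le (sub_nonneg.2 hj1)
  have := hf.north_triangle h k (x₀ + m * i) hi1 (by omega)
  rw [← hk, add_sub_cancel, hs] at this
  cases this

theorem west_run_lt {a b x : ℤ} (h : ∀ y, a ≤ y → y ≤ b → (f x y).1 = .west) :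
    b - a < 2 * m := by
  by_contra hc
  obtain ⟨j, hj1, hj2⟩ := exists_lattice_point hm y₀ a
  obtain ⟨i, hi1, hi2⟩ := exists_lattice_point hm x₀ (x - m + 1)
  obtain ⟨k, hk⟩ := Int.eq_ofNat_of_zero_le (show 0 ≤ x - (x₀ + m * i) by omega)
  have := hf.west_triangle h k (y₀ + m * j) hj1 (by omega)
  rw [← hk, sub_sub_cancel, hs] at this
  cases this

theorem east_run_lt {a b x : ℤ} (h : ∀ y, a ≤ y → y ≤ b → (f x y).1 = .east) :
    b - a < 2 * m := by
  by_contra hc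
  obtain ⟨j, hj1, hj2⟩ := exists_lattice_point hm y₀ a
  obtain ⟨i, hi1, hi2⟩ := exists_lattice_point hm x₀ x
  obtain ⟨k, hk⟩ := Int.eq_ofNat_of_zero_le (sub_nonneg.2 hi1)
  have := hf.east_triangle h k (y₀ + m * j) hj1 (by omega)
  rw [← hk, add_sub_cancel, hs] at this
  cases this

end Bounds

end IsConfiguration

/-- The horizontal interval `[a, b]` of row `y` lies inside a box, from its western to its eastern
wall, and `t` is the top row of that box. -/
def SpanBelow (f : ℤ → ℤ → Mark × ZMod 2) (a b y t : ℤ) : Prop :=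
  a ≤ b ∧ y ≤ t ∧
  (∀ j, y ≤ j → j ≤ t → ((f (a - 1) j).1 = .west ∧ (f a j).1 = .sea) ∧
    (f b j).1 = .sea ∧ (f (b + 1) j).1 = .east) ∧
  ∀ x, a ≤ x → x ≤ b → (f x t).1 = .sea ∧ (f x (t + 1)).1 = .north

namespace IsConfiguration

variable {f : ℤ → ℤ → Mark × ZMod 2} (hf : IsConfiguration f)
  {D : ℤ → ℤ → ℤ} (hH : ∀ x y, D (x + 1) y = D x y + hstep (f x y).1 (f (x + 1) y).1)
  (hV : ∀ x y, D x (y + 1) = D x y + vstep (f x y).1 (f x (y + 1)).1)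

include hf hH

/-- The wall can only stop at a western wall, beyond which the depth would drop below `D a y`. The
hypothesis `hD` excludes this before column `a`. -/
theorem south_wall_reaches_left {a b x y : ℤ} (hD : ∀ z, a ≤ z → z ≤ b → D a y ≤ D z y)
    (hx : a ≤ x) (hxb : x ≤ b) (hDx : D x y = D a y)
    (hw : (f x (y - 1)).1 = .south ∧ (f x y).1 = .sea) : (f a (y - 1)).1 = .south := by
  have key : ∀ z, z ≤ x → a ≤ z →
      ((f z (y - 1)).1 = .south ∧ (f z y).1 = .sea) ∧ D z y = D a y := by
    intro z hz
    induction z, hz using Int.leInductionDown with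
    | base => exact fun _ => ⟨hw, hDx⟩
    | pred z hz ih =>
      intro haz
      obtain ⟨⟨h1, h2⟩, h3⟩ := ih (by omega)
      have hc := hf.curl (z - 1) (y - 1)
      simp only [sub_add_cancel] at hc
      have hd := hH (z - 1) y
      simp only [sub_add_cancel] at hd
      rcases south_wall_left hc h1 h2 with h4 | h4
      · rw [hstep_sea_sea h4.2 h2] at hd
        exact ⟨h4, by omega⟩
      · rw [hstep_west_sea h4 h2] at hd
        have := hD (z - 1) haz (by omega)
        omega
  exact (key a hx le_rfl).1.1

theorem south_wall_reaches_right {a b x y : ℤ} (hD : ∀ z, a ≤ z → z ≤ b → D a y ≤ D z y)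
    (hx : a ≤ x) (hxb : x ≤ b) (hDx : D x y = D a y)
    (hw : (f x (y - 1)).1 = .south ∧ (f x y).1 = .sea) : (f b (y - 1)).1 = .south := by
  have key : ∀ z, x ≤ z → z ≤ b →
      ((f z (y - 1)).1 = .south ∧ (f z y).1 = .sea) ∧ D z y = D a y := by
    intro z hz
    induction z, hz using Int.leInduction with
    | base => exact fun _ => ⟨hw, hDx⟩
    | succ z hz ih =>
      intro hzb
      obtain ⟨⟨h1, h2⟩, h3⟩ := ih (by omega)
      have hc := hf.curl z (y - 1)
      simp only [sub_add_cancel] at hc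
      have hd := hH z y
      rcases south_wall_right hc h1 h2 with h4 | h4
      · rw [hstep_sea_sea h2 h4.2] at hd
        exact ⟨h4, by omega⟩
      · rw [hstep_sea_east h2 h4] at hd
        have := hD (z + 1) (by omega) hzb
        omega
  exact (key b hxb le_rfl).1.1

include hV

/-- Below a northern wall, the western and the eastern walls of the box go down together, and the
depth between them is at least the depth at the walls. -/
theorem walls_below {a b t : ℤ} (hab : a ≤ b)
    (hT : ∀ x, a ≤ x → x ≤ b → (f x t).1 = .sea ∧ (f x (t + 1)).1 = .north)
    (hL : (f (a - 1) t).1 = .west) (hR : (f (b + 1) t).1 = .east) :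
    ∀ y, y ≤ t → ((∀ j, y ≤ j → j ≤ t → (f (a - 1) j).1 = .west ∧ (f a j).1 = .sea) ∨
      (∀ j, y ≤ j → j ≤ t → (f b j).1 = .sea ∧ (f (b + 1) j).1 = .east)) →
      SpanBelow f a b y t ∧ (∀ z, a ≤ z → z ≤ b → D a y ≤ D z y) ∧ D b y = D a y := by
  intro y hy
  induction y, hy using Int.leInductionDown with
  | base =>
    intro _
    have key : ∀ z, a ≤ z → z ≤ b → D z t = D a t := by
      intro z hz
      induction z, hz using Int.leInduction with
      | base => exact fun _ => rfl
      | succ z hz ih =>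
        intro hzb
        rw [hH, hstep_sea_sea (hT z hz (by omega)).1 (hT (z + 1) (by omega) hzb).1, add_zero]
        exact ih (by omega)
    refine ⟨⟨hab, le_rfl, fun j h1 h2 => ?_, hT⟩, fun z h1 h2 => (key z h1 h2).ge, key b hab le_rfl⟩
    rw [le_antisymm h2 h1]
    exact ⟨⟨hL, (hT a le_rfl hab).1⟩, (hT b hab le_rfl).1, hR⟩
  | pred y hy ih =>
    intro hor
    obtain ⟨hS, hD, hDb⟩ := ih (hor.imp (fun h j h1 h2 => h j (by omega) h2)
      (fun h j h1 h2 => h j (by omega) h2))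
    -- A southern wall at the minimal depth would run along all of `[a, b]` and end both side walls,
    -- but one of them is assumed to continue in row `y - 1`.
    have hnw : ∀ x, a ≤ x → x ≤ b → D x y = D a y →
        ¬ ((f x (y - 1)).1 = .south ∧ (f x y).1 = .sea) := by
      intro x h1 h2 h3 h4
      have hl := hf.south_wall_reaches_left hH hD h1 h2 h3 h4
      have hr := hf.south_wall_reaches_right hH hD h1 h2 h3 h4
      rcases hor with h | h
      · have := (h (y - 1) le_rfl (by omega)).2
        rw [hl] at this; cases this
      · have := (h (y - 1) le_rfl (by omega)).1
        rw [hr] at this; cases this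
    obtain ⟨⟨hw1, hw2⟩, he1, he2⟩ := hS.2.2.1 y le_rfl hy
    have hc := hf.curl (a - 1) (y - 1)
    have hc' := hf.curl b (y - 1)
    simp only [sub_add_cancel] at hc hc'
    have hwest := (west_wall_down hc hw1 hw2).resolve_right
      fun h => hnw a le_rfl hab rfl ⟨h, hw2⟩
    have heast := (east_wall_down hc' he1 he2).resolve_right
      fun h => hnw b hab le_rfl hDb ⟨h, he1⟩
    have hDstep : ∀ x, D x y = D x (y - 1) + vstep (f x (y - 1)).1 (f x y).1 := by
      intro x
      simpa only [sub_add_cancel] using hV x (y - 1)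
    have hDa : D a (y - 1) = D a y := by
      rw [hDstep a, hwest.2, hw2]; simp [vstep]
    refine ⟨⟨hab, by omega, fun j h1 h2 => ?_, hT⟩, fun z h1 h2 => ?_, ?_⟩
    · rcases h1.lt_or_eq with h1 | rfl
      · exact hS.2.2.1 j (by omega) h2
      · exact ⟨hwest, heast⟩
    · have h3 := hDstep z
      have h4 := hD z h1 h2
      have h5 := hnw z h1 h2
      -- Going down one row lowers the depth by at most one, and only through a southern wall; `hnw`
      -- forbids this where the depth is minimal.
      have h6 : vstep (f z (y - 1)).1 (f z y).1 ≤ 1 ∧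
          (vstep (f z (y - 1)).1 (f z y).1 = 1 →
            (f z (y - 1)).1 = .south ∧ (f z y).1 = .sea) := by
        generalize (f z (y - 1)).1 = p
        generalize (f z y).1 = q
        revert p q; decide
      by_contra hlt
      exact h5 (by omega) (h6.2 (by omega))
    · rw [hDa, ← hDb, hDstep b, heast.1, he1]; simp [vstep]

end IsConfiguration

/-- Every cell of the labeling recurs along a lattice of odd index step. -/
def OddlyRecurrent (f : ℤ → ℤ → Mark × ZMod 2) : Prop :=
  ∀ x y, ∃ m : ℤ, 0 < m ∧ Odd m ∧ ∀ i j, f (x + m * i) (y + m * j) = f x y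

/-- A product of odd periods is an odd common period, so finite patterns recur as well. -/
theorem OddlyRecurrent.finset {f : ℤ → ℤ → Mark × ZMod 2} (hr : OddlyRecurrent f)
    (s : Finset (ℤ × ℤ)) :
    ∃ m : ℤ, 0 < m ∧ Odd m ∧ ∀ v ∈ s, ∀ i j, f (v.1 + m * i) (v.2 + m * j) = f v.1 v.2 := by
  induction s using Finset.induction_on with
  | empty => exact ⟨1, one_pos, odd_one, by simp⟩
  | insert v s _ ih =>
    obtain ⟨m, hm, hmo, hms⟩ := ih
    obtain ⟨k, hk, hko, hks⟩ := hr v.1 v.2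
    refine ⟨m * k, mul_pos hm hk, hmo.mul hko, fun w hw i j => ?_⟩
    rcases Finset.mem_insert.1 hw with rfl | hw
    · rw [mul_comm m, mul_assoc, mul_assoc, hks]
    · rw [mul_assoc, mul_assoc, hms w hw]

/-- The color relative to the checkerboard pattern. -/
def relColor (f : ℤ → ℤ → Mark × ZMod 2) (x y : ℤ) : ZMod 2 :=
  (f x y).2 + ((x + y : ℤ) : ZMod 2)

namespace IsConfiguration

variable {f : ℤ → ℤ → Mark × ZMod 2} (hf : IsConfiguration f)

include hf

theorem relColor_right {x y : ℤ} (h : hstep (f x y).1 (f (x + 1) y).1 = 0) :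
    relColor f (x + 1) y = relColor f x y := by
  unfold relColor
  rw [(hf x y).2.2.2.2.1 h]
  push_cast
  linear_combination CharTwo.add_self_eq_zero (1 : ZMod 2)

theorem relColor_up {x y : ℤ} (h : vstep (f x y).1 (f x (y + 1)).1 = 0) :
    relColor f x (y + 1) = relColor f x y := by
  unfold relColor
  rw [(hf x y).2.2.2.2.2 h]
  push_cast
  linear_combination CharTwo.add_self_eq_zero (1 : ZMod 2)

theorem relColor_column {m : Mark} {x y t : ℤ} (hm : m ≠ .sea) (hyt : y ≤ t)
    (h : ∀ j, y ≤ j → j ≤ t → (f x j).1 = m) : relColor f x t = relColor f x y := by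
  induction t, hyt using Int.leInduction with
  | base => rfl
  | succ t ht ih =>
    rw [hf.relColor_up, ih fun j h1 h2 => h j h1 (by omega)]
    rw [h t ht (by omega), h (t + 1) (by omega) le_rfl]
    exact vstep_eq_zero (fun h => hm h.2) (fun h => hm h.1)

theorem relColor_row {m : Mark} {y a b : ℤ} (hm : m ≠ .sea) (hab : a ≤ b)
    (h : ∀ x, a ≤ x → x ≤ b → (f x y).1 = m) : relColor f b y = relColor f a y := by
  induction b, hab using Int.leInduction with
  | base => rfl
  | succ t ht ih =>
    rw [hf.relColor_right, ih fun j h1 h2 => h j h1 (by omega)]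
    rw [h t ht (by omega), h (t + 1) (by omega) le_rfl]
    exact hstep_eq_zero (fun h => hm h.2) (fun h => hm h.1)

/-- The relative color agrees on both sides of a span, by a path around the box. -/
theorem relColor_span {a b y t : ℤ} (h : SpanBelow f a b y t) :
    relColor f (b + 1) y = relColor f (a - 1) y := by
  obtain ⟨hab, hyt, hw, ht⟩ := h
  have h1 := hf.relColor_column (m := .west) (by decide) hyt fun j h1 h2 => (hw j h1 h2).1.1
  have h2 : relColor f (a - 1) (t + 1) = relColor f (a - 1) t :=
    hf.relColor_up (by rw [(hw t hyt le_rfl).1.1]; exact vstep_eq_zero (by simp) (by simp))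
  have h3 : relColor f (a - 1 + 1) (t + 1) = relColor f (a - 1) (t + 1) :=
    hf.relColor_right (by
      rw [sub_add_cancel, (ht a le_rfl hab).2]; exact hstep_eq_zero (by simp) (by simp))
  have h4 := hf.relColor_row (m := .north) (by decide) hab fun x h1 h2 => (ht x h1 h2).2
  have h5 : relColor f (b + 1) (t + 1) = relColor f b (t + 1) :=
    hf.relColor_right (by rw [(ht b hab le_rfl).2]; exact hstep_eq_zero (by simp) (by simp))
  have h6 : relColor f (b + 1) (t + 1) = relColor f (b + 1) t :=
    hf.relColor_up (by rw [(hw t hyt le_rfl).2.2]; exact vstep_eq_zero (by simp) (by simp))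
  have h7 := hf.relColor_column (m := .east) (by decide) hyt fun j h1 h2 => (hw j h1 h2).2.2
  rw [sub_add_cancel] at h3
  rw [← h7, ← h6, h5, h4, h3, h2, h1]

theorem exists_north_run_right (hr : OddlyRecurrent f) {a t : ℤ}
    (hs : (f a t).1 = .sea) (hn : (f a (t + 1)).1 = .north) :
    ∃ b, a ≤ b ∧ (∀ x, a ≤ x → x ≤ b → (f x t).1 = .sea ∧ (f x (t + 1)).1 = .north) ∧
      (f (b + 1) t).1 = .east := by
  obtain ⟨m, hm, -, hmr⟩ := hr a t
  refine exists_run_up (P := fun x => (f x t).1 = .sea ∧ (f x (t + 1)).1 = .north) ⟨hs, hn⟩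
    (fun x hx => north_wall_right (hf.curl x t) hx.1 hx.2) fun hall => ?_
  have := hf.north_run_lt hm (fun i j => by rw [hmr]; exact hs)
    (a := a) (b := a + 2 * m) (y := t + 1) fun x h1 _ => (hall x h1).2
  omega

theorem exists_north_run_left (hr : OddlyRecurrent f) {b t : ℤ}
    (hs : (f b t).1 = .sea) (hn : (f b (t + 1)).1 = .north) :
    ∃ a, a ≤ b ∧ (∀ x, a ≤ x → x ≤ b → (f x t).1 = .sea ∧ (f x (t + 1)).1 = .north) ∧
      (f (a - 1) t).1 = .west := by
  obtain ⟨m, hm, -, hmr⟩ := hr b t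
  refine exists_run_down (P := fun x => (f x t).1 = .sea ∧ (f x (t + 1)).1 = .north) ⟨hs, hn⟩
    (fun x hx => ?_) fun hall => ?_
  · have hc := hf.curl (x - 1) t
    rw [sub_add_cancel] at hc
    exact north_wall_left hc hx.1 hx.2
  have := hf.north_run_lt hm (fun i j => by rw [hmr]; exact hs)
    (a := b - 2 * m) (b := b) (y := t + 1) fun x _ h1 => (hall x h1).2
  omega

/-! ### Matching western and eastern walls along a row. -/

section Matching

variable {D : ℤ → ℤ → ℤ} (hH : ∀ x y, D (x + 1) y = D x y + hstep (f x y).1 (f (x + 1) y).1)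
  (hV : ∀ x y, D x (y + 1) = D x y + vstep (f x y).1 (f x (y + 1)).1)

include hH hV

theorem depth_span {a b y t : ℤ} (h : SpanBelow f a b y t) :
    (∀ z, a ≤ z → z ≤ b → D a y ≤ D z y) ∧ D b y = D a y ∧ D (a - 1) y = D a y - 1 ∧
      D (b + 1) y = D a y - 1 := by
  obtain ⟨hab, hyt, hw, ht⟩ := h
  obtain ⟨-, h1, h2⟩ := hf.walls_below hH hV hab ht (hw t hyt le_rfl).1.1 (hw t hyt le_rfl).2.2
    y hyt (.inl fun j h1 h2 => (hw j h1 h2).1)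
  refine ⟨h1, h2, ?_, ?_⟩
  · have := hH (a - 1) y
    rw [sub_add_cancel, hstep_west_sea (hw y le_rfl hyt).1.1 (hw y le_rfl hyt).1.2] at this
    omega
  · rw [hH, hstep_sea_east (hw y le_rfl hyt).2.1 (hw y le_rfl hyt).2.2]
    omega

/-- Two spans of one row are nested or disjoint. -/
theorem span_laminar {a b t a' b' t' y : ℤ} (h : SpanBelow f a b y t)
    (h' : SpanBelow f a' b' y t') (h1 : a' ≤ a) (h2 : a ≤ b') : b ≤ b' := by
  by_contra hc
  obtain ⟨e1, e2, e3, e4⟩ := hf.depth_span hH hV h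
  obtain ⟨e1', e2', e3', e4'⟩ := hf.depth_span hH hV h'
  -- If the spans crossed, `b' + 1` would lie in the first span, with depth at least `D a y ≥ D a'
  -- y`; but the depth just beyond the second span is `D a' y - 1`.
  have h3 := e1 (b' + 1) (by omega) (by omega)
  have h4 := e1' a h1 h2
  omega

/-- A cell to the left of a widest span is in no span. -/
theorem uncovered_of_widest {a b t y : ℤ} (h : SpanBelow f a b y t)
    (hmax : ∀ a' b' t', SpanBelow f a' b' y t' → b' - a' ≤ b - a) (a' b' t' : ℤ)
    (h' : SpanBelow f a' b' y t') : ¬ (a' ≤ a - 1 ∧ a - 1 ≤ b') := by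
  rintro ⟨h1, h2⟩
  rcases lt_or_ge b' a with h3 | h3
  · have h4 := (h'.2.2.1 y le_rfl h'.2.1).2.2
    have h5 := (h.2.2.1 y le_rfl h.2.1).1.2
    rw [show b' + 1 = a by omega, h5] at h4
    cases h4
  · have := hf.span_laminar hH hV h h' (by omega) h3
    have := hmax _ _ _ h'
    omega

variable (hr : OddlyRecurrent f)

include hr

/-- Follow the wall up, which ends because western runs are bounded, then follow the northern wall
to its eastern corner. `walls_below` brings the eastern wall back down to row `y`. -/
theorem exists_span_of_west_wall {a y : ℤ} (hw : (f (a - 1) y).1 = .west)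
    (hs : (f a y).1 = .sea) : ∃ b t, SpanBelow f a b y t := by
  obtain ⟨m, hm, -, hmr⟩ := hr a y
  obtain ⟨t, hyt, hcol, hn⟩ := exists_run_up
    (P := fun j => (f (a - 1) j).1 = .west ∧ (f a j).1 = .sea)
    (Q := fun j => (f a (j + 1)).1 = .north) ⟨hw, hs⟩
    (fun j hj => by
      have hc := hf.curl (a - 1) j
      rw [sub_add_cancel] at hc
      exact west_wall_up hc hj.1 hj.2)
    (fun hall => by
      have := hf.west_run_lt hm (fun i j => by rw [hmr]; exact hs)
        (a := y) (b := y + 2 * m) (x := a - 1) fun x h1 _ => (hall x h1).1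
      omega)
  obtain ⟨b, hab, hT, hR⟩ := hf.exists_north_run_right hr
    (hcol t hyt le_rfl).2 hn
  exact ⟨b, t, (hf.walls_below hH hV hab hT (hcol t hyt le_rfl).1 hR y hyt (.inl hcol)).1⟩

theorem exists_span_of_east_wall {b y : ℤ} (hs : (f b y).1 = .sea)
    (hw : (f (b + 1) y).1 = .east) : ∃ a t, SpanBelow f a b y t := by
  obtain ⟨m, hm, -, hmr⟩ := hr b y
  obtain ⟨t, hyt, hcol, hn⟩ := exists_run_up
    (P := fun j => (f b j).1 = .sea ∧ (f (b + 1) j).1 = .east)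
    (Q := fun j => (f b (j + 1)).1 = .north) ⟨hs, hw⟩
    (fun j hj => east_wall_up (hf.curl b j) hj.1 hj.2)
    (fun hall => by
      have := hf.east_run_lt hm (fun i j => by rw [hmr]; exact hs)
        (a := y) (b := y + 2 * m) (x := b + 1) fun x h1 _ => (hall x h1).2
      omega)
  obtain ⟨a, hab, hT, hL⟩ := hf.exists_north_run_left hr
    (hcol t hyt le_rfl).1 hn
  exact ⟨a, t, (hf.walls_below hH hV hab hT hL (hcol t hyt le_rfl).2 y hyt (.inr hcol)).1⟩

/-- The relative color agrees at any two cells of a row that lie in no span. -/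
theorem relColor_eq_of_uncovered {y : ℤ} (k : ℕ) : ∀ v v' : ℤ, v' = v + k →
    (∀ a b t, SpanBelow f a b y t → ¬ (a ≤ v ∧ v ≤ b)) →
    (∀ a b t, SpanBelow f a b y t → ¬ (a ≤ v' ∧ v' ≤ b)) →
    relColor f v' y = relColor f v y := by
  induction k using Nat.strong_induction_on with
  | _ k ih =>
    intro v v' hk hv hv'
    rcases Nat.eq_zero_or_pos k with rfl | hpos
    · simp only [Nat.cast_zero, add_zero] at hk
      rw [hk]
    have hne : ¬ ((f v y).1 = .sea ∧ (f (v + 1) y).1 = .east) := by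
      rintro ⟨h1, h2⟩
      obtain ⟨a, t, hsp⟩ := hf.exists_span_of_east_wall hH hV hr h1 h2
      exact hv a v t hsp ⟨hsp.1, le_rfl⟩
    by_cases hw : (f v y).1 = .west ∧ (f (v + 1) y).1 = .sea
    -- A span opens right after `v`. It closes before `v'`, and its far side `b + 1` is again
    -- uncovered since spans are laminar, so the induction resumes there.
    · obtain ⟨b, t, hsp⟩ := hf.exists_span_of_west_wall hH hV hr (a := v + 1) (y := y)
        (by rw [add_sub_cancel_right]; exact hw.1) hw.2
      have hcol := hf.relColor_span hsp
      rw [add_sub_cancel_right] at hcol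
      have hb := hsp.1
      have hbv : b < v' := by
        by_contra hc
        exact hv' _ _ _ hsp ⟨by omega, by omega⟩
      rw [← hcol]
      refine ih (v' - (b + 1)).toNat (by omega) (b + 1) v' (by omega) ?_ hv'
      rintro a' b' t' hsp' ⟨h1, h2⟩
      rcases lt_or_ge b a' with h3 | h3
      · have h4 := (hsp.2.2.1 y le_rfl hsp.2.1).2.2
        have h5 := (hsp'.2.2.1 y le_rfl hsp'.2.1).1.2
        rw [show a' = b + 1 by omega, h4] at h5
        cases h5
      · rcases lt_or_ge v a' with h6 | h6
        · have := hf.span_laminar hH hV hsp' hsp (by omega) (by omega)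
          omega
        · exact hv _ _ _ hsp' ⟨h6, by omega⟩
    · have hcol := hf.relColor_right (hstep_eq_zero hw hne)
      rw [← hcol]
      refine ih (k - 1) (by omega) (v + 1) v' (by omega) ?_ hv'
      rintro a' b' t' hsp' ⟨h1, h2⟩
      rcases lt_or_ge v a' with h6 | h6
      · obtain rfl : a' = v + 1 := by omega
        have := (hsp'.2.2.1 y le_rfl hsp'.2.1).1
        rw [add_sub_cancel_right] at this
        exact hw this
      · exact hv _ _ _ hsp' ⟨h6, by omega⟩

end Matching

/-- It suffices to work in row `0`: an uncovered cell and an uncovered odd translate with the same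
label have different relative colors, against `relColor_eq_of_uncovered`. -/
theorem not_oddlyRecurrent : ¬ OddlyRecurrent f := by
  intro hr
  obtain ⟨D, hH, hV⟩ := exists_potential (fun x y => hstep (f x y).1 (f (x + 1) y).1)
    (fun x y => vstep (f x y).1 (f x (y + 1)).1) hf.curl
  suffices ∃ v m : ℤ, 0 < m ∧ Odd m ∧ f (v + m) 0 = f v 0 ∧
      (∀ a b t, SpanBelow f a b 0 t → ¬ (a ≤ v ∧ v ≤ b)) ∧
      ∀ a b t, SpanBelow f a b 0 t → ¬ (a ≤ v + m ∧ v + m ≤ b) by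
    obtain ⟨v, m, hm, hmo, hfv, h1, h2⟩ := this
    have := hf.relColor_eq_of_uncovered hH hV hr m.toNat v (v + m) (by omega) h1 h2
    unfold relColor at this
    rw [hfv, add_right_inj, ← sub_eq_zero, ← Int.cast_sub, ZMod.intCast_eq_zero_iff_even] at this
    rw [show v + m + 0 - (v + 0) = m by ring] at this
    exact (Int.not_even_iff_odd.2 hmo) this
  by_cases hex : ∃ a b t, SpanBelow f a b 0 t
  · obtain ⟨a₀, b₀, t₀, h₀⟩ := hex
    obtain ⟨m, hm, -, hmr⟩ := hr a₀ 0
    have hbd : ∀ a b t, SpanBelow f a b 0 t → b - a < 2 * m := fun a b t h =>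
      hf.north_run_lt hm (fun i j => by rw [hmr]; exact (h₀.2.2.1 0 le_rfl h₀.2.1).1.2)
        fun x h1 h2 => (h.2.2.2 x h1 h2).2
    obtain ⟨w, ⟨a, b, t, h, rfl⟩, hmax⟩ := Int.exists_greatest_of_bdd
      (P := fun w => ∃ a b t, SpanBelow f a b 0 t ∧ w = b - a)
      ⟨2 * m, by rintro w ⟨a, b, t, h, rfl⟩; exact (hbd a b t h).le⟩ ⟨_, a₀, b₀, t₀, h₀, rfl⟩
    have hmax' : ∀ a' b' t', SpanBelow f a' b' 0 t' → b' - a' ≤ b - a :=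
      fun a' b' t' h' => hmax _ ⟨a', b', t', h', rfl⟩
    -- The rectangle contains the widest span, up to its top, together with the adjacent buffer
    -- cells. Its translate by `k` is therefore also a widest span, and the cells just left of the
    -- two are uncovered.
    obtain ⟨k, hk, hko, hkr⟩ := hr.finset
      (Finset.Icc (a - 1) (b + 1) ×ˢ Finset.Icc 0 (t + 1))
    have hshift : ∀ x j, a - 1 ≤ x → x ≤ b + 1 → 0 ≤ j → j ≤ t + 1 → f (x + k) j = f x j := by
      intro x j h1 h2 h3 h4
      have := hkr (x, j) (by simp; omega) 1 0
      simpa using this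
    have hspan : SpanBelow f (a + k) (b + k) 0 t := by
      obtain ⟨hab, hyt, hw, hT⟩ := h
      refine ⟨by omega, hyt, fun j h1 h2 => ?_, fun x h1 h2 => ?_⟩
      · rw [show a + k - 1 = a - 1 + k by ring, show b + k + 1 = b + 1 + k by ring,
          hshift _ _ (by omega) (by omega) (by omega) (by omega),
          hshift _ _ (by omega) (by omega) (by omega) (by omega),
          hshift _ _ (by omega) (by omega) (by omega) (by omega),
          hshift _ _ (by omega) (by omega) (by omega) (by omega)]
        exact hw j h1 h2
      · rw [show x = x - k + k by ring,
          hshift _ _ (by omega) (by omega) (by omega) (by omega),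
          hshift _ _ (by omega) (by omega) (by omega) (by omega)]
        exact hT _ (by omega) (by omega)
    refine ⟨a - 1, k, hk, hko, hshift _ _ le_rfl (by have := h.1; omega) le_rfl
      (by have := h.2.1; omega), hf.uncovered_of_widest hH hV h hmax', ?_⟩
    rw [show a - 1 + k = a + k - 1 by ring]
    exact hf.uncovered_of_widest hH hV hspan (by simpa using hmax')
  · obtain ⟨m, hm, hmo, hmr⟩ := hr 0 0
    refine ⟨0, m, hm, hmo, by simpa using hmr 1 0, ?_, ?_⟩ <;>
      exact fun a b t h => absurd ⟨a, b, t, h⟩ hex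

end IsConfiguration

/-! ### Isolated boxes in a planar pattern -/

/-- The cell `(i, j)` lies in the square with lower left corner `(p, q)` and side `r`. -/
def InBox (p q r i j : ℤ) : Prop :=
  (p ≤ i ∧ i < p + r) ∧ q ≤ j ∧ j < q + r

/-- The cell `(i, j)` lies in the square `(p, q, r)` enlarged by `d` in each direction. -/
def NearBox (d p q r i j : ℤ) : Prop :=
  (p - d ≤ i ∧ i < p + r + d) ∧ q - d ≤ j ∧ j < q + r + d

/-- The cell `(i, j)` lies on the inner boundary of the square `(p, q, r)`. -/
def OnFrame (p q r i j : ℤ) : Prop :=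
  InBox p q r i j ∧ (i = p ∨ i = p + r - 1 ∨ j = q ∨ j = q + r - 1)

/-- The square `(p, q, r)` is isolated in the pattern `w`: its frame is filled with ones, and it
is surrounded by zeros up to distance `4 * r`. -/
def IsBox (w : ℤ → ℤ → Fin 2) (p q r : ℤ) : Prop :=
  0 < r ∧ (∀ i j, OnFrame p q r i j → w i j = 1) ∧
    ∀ i j, NearBox (4 * r) p q r i j → ¬ InBox p q r i j → w i j = 0

section Boxes

variable {w : ℤ → ℤ → Fin 2} {p q r p' q' r' i j i' j' : ℤ}

theorem IsBox.inBox_of_eq_one (h : IsBox w p q r) (hn : NearBox (4 * r) p q r i j)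
    (hw : w i j = 1) : InBox p q r i j := by
  by_contra hc
  rw [h.2.2 i j hn hc] at hw
  exact absurd hw (by decide)

theorem IsBox.subset (h : IsBox w p q r) (h' : IsBox w p' q' r') (hr : r ≤ r')
    (hn : NearBox (3 * r') p' q' r' p q) : (p' ≤ p ∧ p + r ≤ p' + r') ∧ q' ≤ q ∧ q + r ≤ q' + r' := by
  have hr0 := h.1
  obtain ⟨⟨n1, n2⟩, n3, n4⟩ := hn
  have c1 := h'.inBox_of_eq_one (i := p) (j := q) ⟨by omega, by omega⟩
    (h.2.1 p q ⟨⟨by omega, by omega⟩, by omega⟩)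
  have c2 := h'.inBox_of_eq_one (i := p + r - 1) (j := q + r - 1) ⟨by omega, by omega⟩
    (h.2.1 _ _ ⟨⟨by omega, by omega⟩, by omega⟩)
  obtain ⟨c1, c3⟩ := c1
  obtain ⟨c2, c4⟩ := c2
  omega

/-- The smaller box lies inside the larger, since its ones cannot lie in the zeros around the
larger. A collar cell of the larger is close by, so one side of the larger frame passes within the
zero zone of the smaller box. The ones of that side must lie in the smaller box, so the sides
coincide, ends included. The factor 4 in `IsBox` leaves room for the two collars and the gap. -/
theorem IsBox.eq_of_near_of_le (h : IsBox w p q r) (h' : IsBox w p' q' r') (hr : r ≤ r')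
    (hn : NearBox r p q r i j) (hn' : NearBox r' p' q' r' i' j') (ho' : ¬ InBox p' q' r' i' j')
    (hi : |i - i'| ≤ 1) (hj : |j - j'| ≤ 1) : p = p' ∧ q = q' ∧ r = r' := by
  have hr0 := h.1
  rw [abs_le] at hi hj
  obtain ⟨⟨n1, n2⟩, n3, n4⟩ := hn
  obtain ⟨⟨m1, m2⟩, m3, m4⟩ := hn'
  obtain ⟨⟨s1, s2⟩, s3, s4⟩ := h.subset h' hr ⟨by omega, by omega⟩
  have key : ∀ a b, OnFrame p' q' r' a b → NearBox (4 * r) p q r a b → InBox p q r a b :=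
    fun a b hab hnear => h.inBox_of_eq_one hnear (h'.2.1 a b hab)
  unfold InBox at ho'
  have hcase : i' < p' ∨ p' + r' ≤ i' ∨ j' < q' ∨ q' + r' ≤ j' := by omega
  rcases hcase with hc | hc | hc | hc
  · have k1 := key p' q ⟨⟨by omega, by omega⟩, by omega⟩ ⟨by omega, by omega⟩
    have k2 : q' = q := by
      by_contra hne
      have k := key p' (q - 1) ⟨⟨by omega, by omega⟩, by omega⟩ ⟨by omega, by omega⟩
      unfold InBox at k; omega
    have k3 : q + r = q' + r' := by
      by_contra hne
      have k := key p' (q + r) ⟨⟨by omega, by omega⟩, by omega⟩ ⟨by omega, by omega⟩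
      unfold InBox at k; omega
    unfold InBox at k1; omega
  · have k1 := key (p' + r' - 1) q ⟨⟨by omega, by omega⟩, by omega⟩ ⟨by omega, by omega⟩
    have k2 : q' = q := by
      by_contra hne
      have k := key (p' + r' - 1) (q - 1) ⟨⟨by omega, by omega⟩, by omega⟩ ⟨by omega, by omega⟩
      unfold InBox at k; omega
    have k3 : q + r = q' + r' := by
      by_contra hne
      have k := key (p' + r' - 1) (q + r) ⟨⟨by omega, by omega⟩, by omega⟩ ⟨by omega, by omega⟩
      unfold InBox at k; omega
    unfold InBox at k1; omega
  · have k1 := key p q' ⟨⟨by omega, by omega⟩, by omega⟩ ⟨by omega, by omega⟩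
    have k2 : p' = p := by
      by_contra hne
      have k := key (p - 1) q' ⟨⟨by omega, by omega⟩, by omega⟩ ⟨by omega, by omega⟩
      unfold InBox at k; omega
    have k3 : p + r = p' + r' := by
      by_contra hne
      have k := key (p + r) q' ⟨⟨by omega, by omega⟩, by omega⟩ ⟨by omega, by omega⟩
      unfold InBox at k; omega
    unfold InBox at k1; omega
  · have k1 := key p (q' + r' - 1) ⟨⟨by omega, by omega⟩, by omega⟩ ⟨by omega, by omega⟩
    have k2 : p' = p := by
      by_contra hne
      have k := key (p - 1) (q' + r' - 1) ⟨⟨by omega, by omega⟩, by omega⟩ ⟨by omega, by omega⟩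
      unfold InBox at k; omega
    have k3 : p + r = p' + r' := by
      by_contra hne
      have k := key (p + r) (q' + r' - 1) ⟨⟨by omega, by omega⟩, by omega⟩ ⟨by omega, by omega⟩
      unfold InBox at k; omega
    unfold InBox at k1; omega

/-- The collars of two distinct isolated boxes do not touch. -/
theorem IsBox.eq_of_near (h : IsBox w p q r) (h' : IsBox w p' q' r')
    (hn : NearBox r p q r i j) (ho : ¬ InBox p q r i j)
    (hn' : NearBox r' p' q' r' i' j') (ho' : ¬ InBox p' q' r' i' j')
    (hi : |i - i'| ≤ 1) (hj : |j - j'| ≤ 1) : p = p' ∧ q = q' ∧ r = r' := by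
  rcases le_total r r' with hr | hr
  · exact h.eq_of_near_of_le h' hr hn hn' ho' hi hj
  · obtain ⟨h1, h2, h3⟩ := h'.eq_of_near_of_le h hr hn' hn ho (by rwa [abs_sub_comm])
      (by rwa [abs_sub_comm])
    exact ⟨h1.symm, h2.symm, h3.symm⟩

theorem IsBox.eq_of_inBox (h : IsBox w p q r) (h' : IsBox w p' q' r) (hi : InBox p q r i j)
    (hi' : InBox p' q' r i j) : p = p' ∧ q = q' := by
  have hr0 := h.1
  obtain ⟨⟨n1, n2⟩, n3, n4⟩ := hi
  obtain ⟨⟨m1, m2⟩, m3, m4⟩ := hi'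
  have := h.subset h' le_rfl ⟨by omega, by omega⟩
  omega

end Boxes

/-! ### The marks around a single box -/

/-- The mark that the box `(p, q, r)` induces at the cell `(i, j)`. -/
def boxMark (p q r i j : ℤ) : Mark :=
  if q + r ≤ j ∧ p ≤ i ∧ (i - p) + (j - (q + r)) < r then .north
  else if i < p ∧ q ≤ j ∧ (p - 1 - i) + (j - q) < r then .west
  else if p + r ≤ i ∧ q ≤ j ∧ (i - (p + r)) + (j - q) < r then .east
  else if j = q - 1 ∧ p ≤ i ∧ i < p + r then .south
  else .sea

section BoxMark

variable {p q r i j : ℤ}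

theorem boxMark_eq_north_iff :
    boxMark p q r i j = .north ↔ q + r ≤ j ∧ p ≤ i ∧ (i - p) + (j - (q + r)) < r := by
  unfold boxMark; split_ifs <;> simp_all

theorem boxMark_eq_west_iff :
    boxMark p q r i j = .west ↔ i < p ∧ q ≤ j ∧ (p - 1 - i) + (j - q) < r := by
  unfold boxMark; split_ifs <;> simp_all

theorem boxMark_eq_east_iff (hr : 0 < r) :
    boxMark p q r i j = .east ↔ p + r ≤ i ∧ q ≤ j ∧ (i - (p + r)) + (j - q) < r := by
  unfold boxMark; split_ifs <;> simp_all <;> omega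

theorem nearBox_of_boxMark (hr : 0 < r) (h : boxMark p q r i j ≠ .sea) :
    NearBox r p q r i j ∧ ¬ InBox p q r i j := by
  unfold boxMark at h
  unfold NearBox InBox
  split_ifs at h <;> first | omega | exact absurd rfl h

open Classical in
/-- The indicator function of a box. -/
noncomputable def boxDepth (p q r i j : ℤ) : ℤ := if InBox p q r i j then 1 else 0

/-- The western and eastern triangles have their vertical leg on the wall, so no other boundary of a
buffer produces a step. -/
theorem hstep_boxMark (hr : 0 < r) :
    hstep (boxMark p q r i j) (boxMark p q r (i + 1) j) =
      boxDepth p q r (i + 1) j - boxDepth p q r i j := by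
  unfold boxMark boxDepth InBox
  split_ifs <;> first | omega | simp [hstep]

theorem vstep_boxMark (hr : 0 < r) :
    vstep (boxMark p q r i j) (boxMark p q r i (j + 1)) =
      boxDepth p q r i (j + 1) - boxDepth p q r i j := by
  unfold boxMark boxDepth InBox
  split_ifs <;> first | omega | simp [vstep]

end BoxMark

/-! ### The configuration of a planar pattern -/

open Classical in
/-- The mark at `(i, j)` given by the isolated boxes of the pattern `w`. -/
noncomputable def patternMark (w : ℤ → ℤ → Fin 2) (i j : ℤ) : Mark :=
  if h : ∃ b : ℤ × ℤ × ℤ, IsBox w b.1 b.2.1 b.2.2 ∧ boxMark b.1 b.2.1 b.2.2 i j ≠ .sea then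
    boxMark h.choose.1 h.choose.2.1 h.choose.2.2 i j
  else .sea

/-- `(p, q, r)` is a smallest isolated box of `w` that contains `(i, j)`. -/
def IsMinBox (w : ℤ → ℤ → Fin 2) (i j p q r : ℤ) : Prop :=
  (IsBox w p q r ∧ InBox p q r i j) ∧ ∀ p' q' r', IsBox w p' q' r' ∧ InBox p' q' r' i j → r ≤ r'

open Classical in
/-- The color at `(i, j)`: the parity of the position in a smallest isolated box. -/
noncomputable def patternColor (w : ℤ → ℤ → Fin 2) (i j : ℤ) : ZMod 2 :=
  if ∃ p q r, IsMinBox w i j p q r ∧ Even (i + j - (p + q)) then 0 else 1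

/-- The label at `(i, j)` given by the isolated boxes of the pattern `w`. -/
noncomputable def patternLabel (w : ℤ → ℤ → Fin 2) (i j : ℤ) : Mark × ZMod 2 :=
  (patternMark w i j, patternColor w i j)

section Pattern

variable {w : ℤ → ℤ → Fin 2} {p q r i j i' j' : ℤ}

/-- Since collars do not touch, the box visible at one cell determines the marks at all neighboring
cells. -/
theorem patternMark_eq_boxMark (h : IsBox w p q r) (hm : boxMark p q r i j ≠ .sea)
    (hi : |i - i'| ≤ 1) (hj : |j - j'| ≤ 1) : patternMark w i' j' = boxMark p q r i' j' := by
  unfold patternMark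
  split_ifs with hex
  · obtain ⟨h1, h2⟩ := hex.choose_spec
    obtain ⟨n1, o1⟩ := nearBox_of_boxMark h.1 hm
    obtain ⟨n2, o2⟩ := nearBox_of_boxMark h1.1 h2
    obtain ⟨e1, e2, e3⟩ := h.eq_of_near h1 n1 o1 n2 o2 hi hj
    rw [← e1, ← e2, ← e3]
  · by_contra hne
    exact hex ⟨(p, q, r), h, Ne.symm hne⟩

theorem patternMark_eq_iff {m : Mark} (hm : m ≠ .sea) :
    patternMark w i j = m ↔ ∃ p q r, IsBox w p q r ∧ boxMark p q r i j = m := by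
  constructor
  · intro h
    unfold patternMark at h
    split_ifs at h with hex
    · exact ⟨_, _, _, hex.choose_spec.1, h⟩
    · exact absurd h.symm hm
  · rintro ⟨p, q, r, h, rfl⟩
    exact patternMark_eq_boxMark h hm (by simp) (by simp)

/-- In a two by two window, at most one box is visible. -/
theorem exists_boxMark_window (w : ℤ → ℤ → Fin 2) (i j : ℤ) : ∃ p q r, 0 < r ∧
    ∀ a b, i ≤ a → a ≤ i + 1 → j ≤ b → b ≤ j + 1 → patternMark w a b = boxMark p q r a b := by
  by_cases hex : ∃ p q r a b, IsBox w p q r ∧ boxMark p q r a b ≠ .sea ∧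
      i ≤ a ∧ a ≤ i + 1 ∧ j ≤ b ∧ b ≤ j + 1
  · obtain ⟨p, q, r, a, b, h, hm, h1, h2, h3, h4⟩ := hex
    refine ⟨p, q, r, h.1, fun a' b' h5 h6 h7 h8 => patternMark_eq_boxMark h hm ?_ ?_⟩ <;>
      rw [abs_le] <;> omega
  -- No box is visible: a dummy unit box, too far away to mark the window, stands for the constant
  -- `sea`.
  · refine ⟨i + 10, j + 10, 1, one_pos, fun a b h1 h2 h3 h4 => ?_⟩
    have h5 : boxMark (i + 10) (j + 10) 1 a b = .sea := by
      by_contra hc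
      have := (nearBox_of_boxMark one_pos hc).1
      unfold NearBox at this
      omega
    rw [h5]
    by_contra hc
    obtain ⟨p, q, r, h, hm⟩ := (patternMark_eq_iff hc).1 rfl
    exact hex ⟨p, q, r, a, b, h, by rwa [hm], h1, h2, h3, h4⟩

theorem IsMinBox.unique {p' q' r' : ℤ} (h : IsMinBox w i j p q r) (h' : IsMinBox w i j p' q' r') :
    p = p' ∧ q = q' := by
  obtain rfl := le_antisymm (h.2 _ _ _ h'.1) (h'.2 _ _ _ h.1)
  exact h.1.1.eq_of_inBox h'.1.1 h.1.2 h'.1.2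

open Classical in
theorem IsMinBox.patternColor_eq (h : IsMinBox w i j p q r) :
    patternColor w i j = ((i + j - (p + q) : ℤ) : ZMod 2) := by
  rw [CharTwo.intCast_eq_ite, patternColor]
  refine if_congr ⟨?_, fun he => ⟨p, q, r, h, he⟩⟩ rfl rfl
  rintro ⟨p', q', r', h', he⟩
  rwa [(h.unique h').1, (h.unique h').2]

theorem exists_isMinBox (h : ∃ p q r, IsBox w p q r ∧ InBox p q r i j) :
    ∃ p q r, IsMinBox w i j p q r := by
  obtain ⟨p₀, q₀, r₀, h₀⟩ := h
  obtain ⟨r, ⟨p, q, h1⟩, hr⟩ := Int.exists_least_of_bdd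
    (P := fun r => ∃ p q, IsBox w p q r ∧ InBox p q r i j)
    ⟨0, by rintro r ⟨p, q, h1, -⟩; exact h1.1.le⟩ ⟨r₀, p₀, q₀, h₀⟩
  exact ⟨p, q, r, h1, fun p' q' r' h' => hr r' ⟨p', q', h'⟩⟩

/-- Cells in the same boxes have the same smallest box, hence the same origin for the parity. -/
theorem patternColor_add_one (hcov : ∃ p q r, IsBox w p q r ∧ InBox p q r i j)
    (hadj : i' + j' = i + j + 1)
    (hiff : ∀ p q r, IsBox w p q r → (InBox p q r i j ↔ InBox p q r i' j')) :
    patternColor w i' j' = patternColor w i j + 1 := by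
  obtain ⟨p, q, r, h⟩ := exists_isMinBox hcov
  have h' : IsMinBox w i' j' p q r :=
    ⟨⟨h.1.1, (hiff _ _ _ h.1.1).1 h.1.2⟩,
      fun a b c hb => h.2 a b c ⟨hb.1, (hiff _ _ _ hb.1).2 hb.2⟩⟩
  rw [h.patternColor_eq, h'.patternColor_eq, hadj]
  push_cast
  ring

theorem hstep_patternMark_iff (h0 : hstep (patternMark w i j) (patternMark w (i + 1) j) = 0)
    (h : IsBox w p q r) : InBox p q r i j ↔ InBox p q r (i + 1) j := by
  by_contra hne
  have h1 := hstep_boxMark (p := p) (q := q) (i := i) (j := j) h.1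
  have h2 : hstep (boxMark p q r i j) (boxMark p q r (i + 1) j) ≠ 0 := by
    rw [h1]; unfold boxDepth; split_ifs <;> simp_all
  have h3 : boxMark p q r i j ≠ .sea ∨ boxMark p q r (i + 1) j ≠ .sea := by
    by_contra! hc
    rw [hc.1, hc.2] at h2
    exact h2 rfl
  apply h2
  rcases h3 with h3 | h3
  · rwa [← patternMark_eq_boxMark h h3 (by simp) (by simp),
      ← patternMark_eq_boxMark h h3 (by simp) (by simp)]
  · rwa [← patternMark_eq_boxMark h h3 (by simp) (by simp),
      ← patternMark_eq_boxMark h h3 (by simp) (by simp)]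

theorem vstep_patternMark_iff (h0 : vstep (patternMark w i j) (patternMark w i (j + 1)) = 0)
    (h : IsBox w p q r) : InBox p q r i j ↔ InBox p q r i (j + 1) := by
  by_contra hne
  have h1 := vstep_boxMark (p := p) (q := q) (i := i) (j := j) h.1
  have h2 : vstep (boxMark p q r i j) (boxMark p q r i (j + 1)) ≠ 0 := by
    rw [h1]; unfold boxDepth; split_ifs <;> simp_all
  have h3 : boxMark p q r i j ≠ .sea ∨ boxMark p q r i (j + 1) ≠ .sea := by
    by_contra! hc
    rw [hc.1, hc.2] at h2
    exact h2 rfl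
  apply h2
  rcases h3 with h3 | h3
  · rwa [← patternMark_eq_boxMark h h3 (by simp) (by simp),
      ← patternMark_eq_boxMark h h3 (by simp) (by simp)]
  · rwa [← patternMark_eq_boxMark h h3 (by simp) (by simp),
      ← patternMark_eq_boxMark h h3 (by simp) (by simp)]

/-- If every cell lies in an isolated box, the labels satisfy the local rule. -/
theorem isConfiguration_patternLabel
    (hcov : ∀ i j, ∃ p q r, IsBox w p q r ∧ InBox p q r i j) :
    IsConfiguration (patternLabel w) := by
  intro i j
  obtain ⟨p, q, r, hr, hm⟩ := exists_boxMark_window w i j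
  have m1 := hm i j le_rfl (by omega) le_rfl (by omega)
  have m2 := hm (i + 1) j (by omega) le_rfl le_rfl (by omega)
  have m3 := hm i (j + 1) le_rfl (by omega) (by omega) le_rfl
  have m4 := hm (i + 1) (j + 1) (by omega) le_rfl (by omega) le_rfl
  refine ⟨?_, ?_, ?_, ?_, fun h => ?_, fun h => ?_⟩
  · simp only [patternLabel, m1, m2, m3, m4]
    rw [hstep_boxMark hr, hstep_boxMark hr, vstep_boxMark hr, vstep_boxMark hr]
    ring
  · simp only [patternLabel, m1, m2, m3, boxMark_eq_north_iff]
    omega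
  · simp only [patternLabel, m1, m2, m4, boxMark_eq_west_iff]
    omega
  · simp only [patternLabel, m1, m2, m3, boxMark_eq_east_iff hr]
    omega
  · exact patternColor_add_one (hcov i j) (by ring) fun _ _ _ => hstep_patternMark_iff h
  · exact patternColor_add_one (hcov i j) (by ring) fun _ _ _ => vstep_patternMark_iff h

end Pattern

/-! ### Equivariance -/

section Translate

variable (w : ℤ → ℤ → Fin 2) (a b : ℤ)

theorem isBox_translate (p q r : ℤ) :
    IsBox (fun i j => w (i + a) (j + b)) p q r ↔ IsBox w (p + a) (q + b) r := by
  unfold IsBox OnFrame NearBox InBox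
  refine and_congr_right fun _ => and_congr ⟨fun h i j hij => ?_, fun h i j hij => ?_⟩
    ⟨fun h i j h1 h2 => ?_, fun h i j h1 h2 => ?_⟩
  · simpa using h (i - a) (j - b) (by omega)
  · exact h _ _ (by omega)
  · simpa using h (i - a) (j - b) (by omega) (by omega)
  · exact h _ _ (by omega) (by omega)

theorem boxMark_translate (p q r i j : ℤ) :
    boxMark (p + a) (q + b) r (i + a) (j + b) = boxMark p q r i j := by
  unfold boxMark
  split_ifs <;> first | rfl | omega

/-- The mark is defined through a choice of box, so it is compared through `patternMark_eq_iff`,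
which does not mention the choice. -/
theorem patternMark_translate (i j : ℤ) :
    patternMark (fun i j => w (i + a) (j + b)) i j = patternMark w (i + a) (j + b) := by
  have key : ∀ m : Mark, m ≠ .sea →
      (patternMark (fun i j => w (i + a) (j + b)) i j = m ↔
        patternMark w (i + a) (j + b) = m) := by
    intro m hm
    rw [patternMark_eq_iff hm, patternMark_eq_iff hm]
    constructor
    · rintro ⟨p, q, r, h1, h2⟩
      exact ⟨p + a, q + b, r, (isBox_translate w a b p q r).1 h1, by rwa [boxMark_translate]⟩
    · rintro ⟨p, q, r, h1, h2⟩
      refine ⟨p - a, q - b, r, (isBox_translate w a b _ _ r).2 (by simpa using h1), ?_⟩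
      rw [← boxMark_translate a b]
      simpa using h2
  by_cases h : patternMark w (i + a) (j + b) = .sea
  · rw [h]
    by_contra hc
    exact hc (((key _ hc).1 rfl).symm.trans h)
  · exact (key _ h).2 rfl

theorem isMinBox_translate (i j p q r : ℤ) :
    IsMinBox (fun i j => w (i + a) (j + b)) i j p q r ↔
      IsMinBox w (i + a) (j + b) (p + a) (q + b) r := by
  have hin : ∀ p q r, InBox p q r i j ↔ InBox (p + a) (q + b) r (i + a) (j + b) := by
    intro p q r
    unfold InBox
    omega
  unfold IsMinBox
  refine and_congr (and_congr (isBox_translate ..) (hin ..)) ⟨fun h p' q' r' h' => ?_,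
    fun h p' q' r' h' => ?_⟩
  · refine h (p' - a) (q' - b) r' ⟨(isBox_translate w a b _ _ _).2 ?_, (hin _ _ _).2 ?_⟩
    · simpa using h'.1
    · simpa using h'.2
  · exact h _ _ r' ⟨(isBox_translate w a b _ _ _).1 h'.1, (hin _ _ _).1 h'.2⟩

open Classical in
theorem patternColor_translate (i j : ℤ) :
    patternColor (fun i j => w (i + a) (j + b)) i j = patternColor w (i + a) (j + b) := by
  unfold patternColor
  refine if_congr ⟨?_, ?_⟩ rfl rfl
  · rintro ⟨p, q, r, h1, h2⟩
    refine ⟨p + a, q + b, r, (isMinBox_translate ..).1 h1, ?_⟩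
    rwa [show i + a + (j + b) - (p + a + (q + b)) = i + j - (p + q) by ring]
  · rintro ⟨p, q, r, h1, h2⟩
    refine ⟨p - a, q - b, r, (isMinBox_translate ..).2 (by simpa using h1), ?_⟩
    rwa [show i + j - (p - a + (q - b)) = i + a + (j + b) - (p + q) by ring]

theorem patternLabel_translate (i j : ℤ) :
    patternLabel (fun i j => w (i + a) (j + b)) i j = patternLabel w (i + a) (j + b) :=
  Prod.ext (patternMark_translate w a b i j) (patternColor_translate w a b i j)

end Translate

/-! ### The nested box problem on `ℤⁿ` -/

section Problem

variable {n : ℕ} (hn : 2 ≤ n)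

/-- The vector with first two coordinates `i` and `j`. -/
def planeVec (i j : ℤ) : Fin n → ℤ :=
  Pi.single ⟨0, by omega⟩ i + Pi.single ⟨1, by omega⟩ j

theorem planeVec_add (i j a b : ℤ) :
    planeVec hn (i + a) (j + b) = planeVec hn i j + planeVec hn a b := by
  simp only [planeVec, Pi.single_add]
  abel

theorem planeVec_apply_zero (i j : ℤ) : planeVec hn i j ⟨0, by omega⟩ = i := by
  simp [planeVec]

theorem planeVec_apply_one (i j : ℤ) : planeVec hn i j ⟨1, by omega⟩ = j := by
  simp [planeVec]

/-- The local rule imposed on the planes spanned by the first two coordinates. -/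
def nestedBoxProblem : LCLProblem.{v, 0} (Fin n → ℤ) where
  window := {planeVec hn 0 0, planeVec hn 1 0, planeVec hn 0 1, planeVec hn 1 1}
  Label := ULift.{v} (Mark × ZMod 2)
  finite_label := inferInstance
  allowed := {g | LocalRule (g ⟨planeVec hn 0 0, by simp⟩).down (g ⟨planeVec hn 1 0, by simp⟩).down
    (g ⟨planeVec hn 0 1, by simp⟩).down (g ⟨planeVec hn 1 1, by simp⟩).down}

theorem isSolution_nestedBoxProblem_iff {X : Type u} [AddAction (Fin n → ℤ) X]
    (f : X → ULift.{v} (Mark × ZMod 2)) :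
    (nestedBoxProblem.{v} hn).IsSolution f ↔
      ∀ x, IsConfiguration fun i j => (f (planeVec hn i j +ᵥ x)).down := by
  constructor
  · intro h x i j
    have h1 : LocalRule (f (planeVec hn 0 0 +ᵥ planeVec hn i j +ᵥ x)).down
        (f (planeVec hn 1 0 +ᵥ planeVec hn i j +ᵥ x)).down
        (f (planeVec hn 0 1 +ᵥ planeVec hn i j +ᵥ x)).down
        (f (planeVec hn 1 1 +ᵥ planeVec hn i j +ᵥ x)).down := h (planeVec hn i j +ᵥ x)
    simpa only [← add_vadd, ← planeVec_add, zero_add, add_comm (1 : ℤ)] using h1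
  · intro h x
    have h1 := h x 0 0
    simp only [zero_add] at h1
    exact h1

/-- The restriction of `x` to the plane through the origin. -/
def planePattern (x : (Fin n → ℤ) → Fin 2) : ℤ → ℤ → Fin 2 :=
  fun i j => x (planeVec hn i j)

theorem planePattern_shift (x : (Fin n → ℤ) → Fin 2) (a b : ℤ) :
    planePattern hn (shift (planeVec hn a b) x) =
      fun i j => planePattern hn x (i + a) (j + b) := by
  funext i j
  simp only [planePattern, shift, planeVec_add]

/-- Every translate of `x` has an isolated box around the origin of the plane. -/
def IsBoxCovered (x : (Fin n → ℤ) → Fin 2) : Prop :=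
  ∀ γ, ∃ p q r, IsBox (planePattern hn (shift γ x)) p q r ∧ InBox p q r 0 0

theorem isBoxCovered_shift (γ : Fin n → ℤ) (x : (Fin n → ℤ) → Fin 2) :
    IsBoxCovered hn (shift γ x) ↔ IsBoxCovered hn x := by
  simp only [IsBoxCovered, ← shift_add]
  exact ⟨fun h δ => by simpa using h (δ - γ), fun h δ => h _⟩

theorem IsBoxCovered.isConfiguration {x : (Fin n → ℤ) → Fin 2} (h : IsBoxCovered hn x) :
    IsConfiguration (patternLabel (planePattern hn x)) := by
  refine isConfiguration_patternLabel fun i j => ?_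
  obtain ⟨p, q, r, h1, h2⟩ := h (planeVec hn i j)
  rw [planePattern_shift, isBox_translate] at h1
  refine ⟨p + i, q + j, r, h1, ?_⟩
  unfold InBox at *
  omega

/-! ### Topology of the shift -/

theorem continuous_shift {Γ : Type w} [AddGroup Γ] {X : Type u} [TopologicalSpace X] (γ : Γ) :
    Continuous (shift γ : (Γ → X) → Γ → X) :=
  continuous_pi fun _ => continuous_apply _

theorem isOpenMap_shift {Γ : Type w} [AddGroup Γ] {X : Type u} [TopologicalSpace X] (γ : Γ) :
    IsOpenMap (shift γ : (Γ → X) → Γ → X) :=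
  IsOpenMap.of_inverse (f' := shift (-γ)) (continuous_shift _)
    (fun x => by rw [← shift_add, add_neg_cancel, shift_zero])
    (fun x => by rw [← shift_add, neg_add_cancel, shift_zero])

theorem exists_finset_of_isOpen {Γ : Type w} {X : Type u} [TopologicalSpace X]
    {s : Set (Γ → X)} (hs : IsOpen s) {x : Γ → X} (hx : x ∈ s) :
    ∃ I : Finset Γ, ∀ x' : Γ → X, (∀ γ ∈ I, x' γ = x γ) → x' ∈ s := by
  obtain ⟨I, u, h1, h2⟩ := isOpen_pi_iff.1 hs x hx
  exact ⟨I, fun x' h => h2 fun γ hγ => by rw [h γ hγ]; exact (h1 γ hγ).2⟩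

theorem isOpen_shift_ne {Γ : Type w} [AddGroup Γ] {X : Type u} [TopologicalSpace X] [T2Space X]
    (γ : Γ) : IsOpen {x : Γ → X | shift γ x ≠ x} :=
  isOpen_ne_fun (continuous_shift γ) continuous_id

theorem dense_shift_ne {Γ : Type w} [AddGroup Γ] [Infinite Γ] {X : Type u} [TopologicalSpace X]
    [Nontrivial X] {γ : Γ} (hγ : γ ≠ 0) : Dense {x : Γ → X | shift γ x ≠ x} := by
  classical
  rw [dense_iff_inter_open]
  rintro U hU ⟨x, hx⟩
  obtain ⟨I, hI⟩ := exists_finset_of_isOpen hU hx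
  obtain ⟨δ, hδ⟩ := Infinite.exists_notMem_finset (I ∪ I.image (· - γ))
  rw [Finset.mem_union, not_or] at hδ
  obtain ⟨a, b, hab⟩ := exists_pair_ne X
  have hne : δ ≠ δ + γ := by simpa using hγ
  -- Neither `δ` nor `δ + γ` lies in `I`, so changing both values stays in `U`.
  refine ⟨Function.update (Function.update x δ a) (δ + γ) b, hI _ fun ε hε => ?_, fun h => ?_⟩
  · rw [Function.update_of_ne, Function.update_of_ne]
    · rintro rfl; exact hδ.1 hε
    · rintro rfl; exact hδ.2 (Finset.mem_image.2 ⟨_, hε, by simp⟩)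
  · have := congrFun h δ
    rw [shift, Function.update_self, Function.update_of_ne hne, Function.update_self] at this
    exact hab this.symm

theorem dense_freePart (Γ : Type w) [AddGroup Γ] [Countable Γ] [Infinite Γ] :
    Dense (freePart (Fin 2) Γ) := by
  apply dense_of_mem_residual
  have : ∀ γ : Γ, ∀ᶠ x in residual (Γ → Fin 2), γ ≠ 0 → shift γ x ≠ x := by
    intro γ
    by_cases hγ : γ = 0
    · simp [hγ]
    · filter_upwards [residual_of_dense_open (isOpen_shift_ne γ) (dense_shift_ne hγ)]
        with x hx _ using hx
  exact eventually_countable_forall.2 this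

/-! ### Generic points are covered by boxes -/

theorem isOpen_setOf_isBox (p q r : ℤ) :
    IsOpen {x : (Fin n → ℤ) → Fin 2 | IsBox (planePattern hn x) p q r} := by
  by_cases hr : 0 < r
  · have h : {x : (Fin n → ℤ) → Fin 2 | IsBox (planePattern hn x) p q r} =
        ⋂ c ∈ Finset.Icc (p - 4 * r) (p + r + 4 * r) ×ˢ Finset.Icc (q - 4 * r) (q + r + 4 * r),
          {x | (OnFrame p q r c.1 c.2 → planePattern hn x c.1 c.2 = 1) ∧
            (NearBox (4 * r) p q r c.1 c.2 → ¬ InBox p q r c.1 c.2 →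
              planePattern hn x c.1 c.2 = 0)} := by
      ext x
      simp only [Set.mem_ofPred_eq, Set.mem_iInter, IsBox]
      refine ⟨fun h c _ => ⟨h.2.1 _ _, h.2.2 _ _⟩, fun h => ⟨hr, fun i j hij => ?_,
        fun i j hij => ?_⟩⟩
      · refine (h (i, j) ?_).1 hij
        unfold OnFrame InBox at hij
        simp only [Finset.mem_product, Finset.mem_Icc]
        omega
      · refine (h (i, j) ?_).2 hij
        unfold NearBox at hij
        simp only [Finset.mem_product, Finset.mem_Icc]
        omega
    rw [h]
    refine isOpen_biInter_finset fun c _ => ?_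
    have hc : Continuous fun x : (Fin n → ℤ) → Fin 2 => planePattern hn x c.1 c.2 :=
      continuous_apply _
    exact (isOpen_discrete {t : Fin 2 | (OnFrame p q r c.1 c.2 → t = 1) ∧
      (NearBox (4 * r) p q r c.1 c.2 → ¬ InBox p q r c.1 c.2 → t = 0)}).preimage hc
  · simp [IsBox, hr]

theorem isOpen_setOf_exists_isBox : IsOpen {x : (Fin n → ℤ) → Fin 2 |
    ∃ p q r, IsBox (planePattern hn x) p q r ∧ InBox p q r 0 0} := by
  simp only [Set.ofPred_exists, Set.ofPred_and]
  exact isOpen_iUnion fun p => isOpen_iUnion fun q => isOpen_iUnion fun r =>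
    (isOpen_setOf_isBox hn p q r).inter isOpen_const

/-- A basic open set fixes finitely many coordinates, and a large enough frame can be drawn around
their projection to the plane. -/
theorem dense_setOf_exists_isBox : Dense {x : (Fin n → ℤ) → Fin 2 |
    ∃ p q r, IsBox (planePattern hn x) p q r ∧ InBox p q r 0 0} := by
  rw [dense_iff_inter_open]
  rintro U hU ⟨x, hx⟩
  obtain ⟨I, hI⟩ := exists_finset_of_isOpen hU hx
  obtain ⟨R, hR⟩ := (I.image fun γ => max |γ ⟨0, by omega⟩| |γ ⟨1, by omega⟩|).bddAbove
  have hR' : ∀ γ ∈ I, max |γ ⟨0, by omega⟩| |γ ⟨1, by omega⟩| ≤ R := fun γ hγ =>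
    hR (Finset.mem_coe.2 (Finset.mem_image_of_mem _ hγ))
  obtain ⟨S, hS, hS0⟩ : ∃ S, R < S ∧ 0 < S := ⟨max R 0 + 1, by omega, by omega⟩
  let M : (Fin n → ℤ) → ℤ := fun γ => max |γ ⟨0, by omega⟩| |γ ⟨1, by omega⟩|
  -- The sphere of radius `S` in the maximum norm is the frame of the square with corner `(-S, -S)`
  -- and side `2 * S + 1`. Everything outside is set to zero.
  refine ⟨fun γ => if M γ < S then x γ else if M γ = S then 1 else 0,
    hI _ fun γ hγ => if_pos ((hR' γ hγ).trans_lt hS), -S, -S, 2 * S + 1,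
    ⟨by omega, fun i j hij => ?_, fun i j hij hij' => ?_⟩, by unfold InBox; omega⟩
  · unfold OnFrame InBox at hij
    simp only [planePattern, M, planeVec_apply_zero, planeVec_apply_one]
    have : max |i| |j| = S := by simp only [abs_eq_max_neg]; omega
    simp [this]
  · unfold InBox at hij'
    simp only [planePattern, M, planeVec_apply_zero, planeVec_apply_one]
    have : S < max |i| |j| := by simp only [abs_eq_max_neg]; omega
    rw [if_neg this.not_gt, if_neg this.ne']

theorem eventually_isBoxCovered :
    ∀ᶠ x : freePart (Fin 2) (Fin n → ℤ) in residual _, IsBoxCovered hn x.1 := by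
  have : Nonempty (Fin n) := ⟨⟨0, by omega⟩⟩
  refine eventually_countable_forall.2 fun γ => ?_
  have ho := (isOpen_setOf_exists_isBox hn).preimage (continuous_shift γ)
  have hd := (dense_setOf_exists_isBox hn).preimage (isOpenMap_shift γ)
  refine residual_of_dense_open (ho.preimage continuous_subtype_val) ?_
  rw [dense_iff_inter_open]
  rintro U hU ⟨x, hx⟩
  obtain ⟨V, hV, rfl⟩ := isOpen_induced_iff.1 hU
  have hne := hd.inter_open_nonempty V hV ⟨x.1, hx⟩
  obtain ⟨z, ⟨hz1, hz2⟩, hz3⟩ := (dense_freePart (Fin n → ℤ)).inter_open_nonempty _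
    (hV.inter ho) hne
  exact ⟨⟨z, hz3⟩, hz1, hz2⟩

end Problem

/-! ### The nested box problem on the free part of the shift -/

/-- Choose a base point in each orbit. The map need not be measurable, as it only serves to color a
meagre set. -/
theorem exists_equivariant_map {Γ : Type w} [AddGroup Γ] {X : Type u} [AddAction Γ X]
    (h : IsFreeAction Γ X) : ∃ κ : X → Γ, ∀ γ x, κ (γ +ᵥ x) = γ + κ x := by
  have hex : ∀ x : X, ∃ γ : Γ, γ +ᵥ (Quotient.out (Quotient.mk (AddAction.orbitRel Γ X) x)) = x :=
    fun x => (AddAction.orbitRel Γ X).symm (Quotient.mk_out (s := AddAction.orbitRel Γ X) x)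
  choose κ hκ using hex
  refine ⟨κ, fun γ x => ?_⟩
  have hq : (Quotient.mk (AddAction.orbitRel Γ X) (γ +ᵥ x)) =
      Quotient.mk (AddAction.orbitRel Γ X) x := Quotient.sound ⟨γ, rfl⟩
  have h1 := hκ (γ +ᵥ x)
  have h2 := hκ x
  rw [hq] at h1
  by_contra hne
  refine h (-(γ + κ x) + κ (γ +ᵥ x)) (fun h0 => hne ?_)
    (Quotient.out (Quotient.mk (AddAction.orbitRel Γ X) x)) ?_
  · rw [neg_add_eq_zero] at h0
    exact h0.symm
  · rw [add_vadd, h1, neg_vadd_eq_iff, add_vadd, h2]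

theorem isFreeAction_freePart (X : Type u) (Γ : Type w) [AddGroup Γ] :
    IsFreeAction Γ (freePart X Γ) :=
  fun γ hγ x hx => x.2 γ hγ (congrArg Subtype.val hx)

section Solution

variable {n : ℕ} (hn : 2 ≤ n)

theorem measurableSet_patternLabel_preimage [MeasurableSpace (freePart (Fin 2) (Fin n → ℤ))]
    [BorelSpace (freePart (Fin 2) (Fin n → ℤ))] (s : Set (Mark × ZMod 2)) :
    MeasurableSet {x : freePart (Fin 2) (Fin n → ℤ) |
      patternLabel (planePattern hn x.1) 0 0 ∈ s} := by
  have hbox : ∀ p q r, Measurable fun x : freePart (Fin 2) (Fin n → ℤ) =>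
      IsBox (planePattern hn x.1) p q r := fun p q r =>
    measurableSet_setOfPred.1
      ((isOpen_setOf_isBox hn p q r).preimage continuous_subtype_val).measurableSet
  have hm : ∀ m : Mark, m ≠ .sea → MeasurableSet {x : freePart (Fin 2) (Fin n → ℤ) |
      patternMark (planePattern hn x.1) 0 0 = m} := by
    intro m hm
    simp only [patternMark_eq_iff hm]
    exact measurableSet_setOfPred.2 <| .exists fun p => .exists fun q => .exists fun r =>
      (hbox p q r).and measurable_const
  have hmark : ∀ m : Mark, MeasurableSet {x : freePart (Fin 2) (Fin n → ℤ) |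
      patternMark (planePattern hn x.1) 0 0 = m} := by
    intro m
    by_cases hs : m = .sea
    · subst hs
      have : {x : freePart (Fin 2) (Fin n → ℤ) | patternMark (planePattern hn x.1) 0 0 = .sea} =
          {x | ∀ m : Mark, m ≠ .sea → ¬ patternMark (planePattern hn x.1) 0 0 = m} := by
        ext x
        exact ⟨fun h m hm h' => hm (h'.symm.trans h), fun h => by
          by_contra hc
          exact h _ hc rfl⟩
      rw [this]
      refine measurableSet_setOfPred.2 <| .forall fun m => ?_
      by_cases hm' : m = .sea
      · simp [hm']
      · simpa [hm'] using measurableSet_setOfPred.1 (hm m hm').compl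
    · exact hm m hs
  have hcol0 : MeasurableSet {x : freePart (Fin 2) (Fin n → ℤ) |
      patternColor (planePattern hn x.1) 0 0 = 0} := by
    have : {x : freePart (Fin 2) (Fin n → ℤ) | patternColor (planePattern hn x.1) 0 0 = 0} =
        {x | ∃ p q r, IsMinBox (planePattern hn x.1) 0 0 p q r ∧ Even (0 + 0 - (p + q))} := by
      ext x
      simp [patternColor]
    rw [this]
    refine measurableSet_setOfPred.2 <| .exists fun p => .exists fun q => .exists fun r =>
      .and (.and ((hbox p q r).and measurable_const) ?_) measurable_const
    exact .forall fun p => .forall fun q => .forall fun r =>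
      .imp ((hbox p q r).and measurable_const) measurable_const
  have hcol : ∀ c : ZMod 2, MeasurableSet {x : freePart (Fin 2) (Fin n → ℤ) |
      patternColor (planePattern hn x.1) 0 0 = c} := by
    intro c
    have hc : c = 0 ∨ c = 1 := by revert c; decide
    rcases hc with rfl | rfl
    · exact hcol0
    · have : {x : freePart (Fin 2) (Fin n → ℤ) | patternColor (planePattern hn x.1) 0 0 = 1} =
          {x | patternColor (planePattern hn x.1) 0 0 = 0}ᶜ := by
        ext x
        have : ∀ c : ZMod 2, c = 1 ↔ ¬ c = 0 := by decide
        exact this _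
      rw [this]
      exact hcol0.compl
  have : {x : freePart (Fin 2) (Fin n → ℤ) | patternLabel (planePattern hn x.1) 0 0 ∈ s} =
      ⋃ l ∈ s, {x | patternMark (planePattern hn x.1) 0 0 = l.1} ∩
        {x | patternColor (planePattern hn x.1) 0 0 = l.2} := by
    ext x
    simp only [Set.mem_ofPred_eq, Set.mem_iUnion, Set.mem_inter_iff, patternLabel]
    constructor
    · exact fun h => ⟨_, h, rfl, rfl⟩
    · rintro ⟨l, hl, h1, h2⟩
      rw [h1, h2]
      exact hl
  rw [this]
  exact MeasurableSet.biUnion s.to_countable fun l _ => (hmark l.1).inter (hcol l.2)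

/-- Off the invariant comeagre set of covered points every mark is `sea` and each orbit carries a
checkerboard. On that set the solution agrees with a Borel map. -/
theorem nestedBoxProblem_mem_baireSHIFT :
    nestedBoxProblem.{v} hn ∈ BaireSHIFT.{v, 0} (Fin n → ℤ) := by
  classical
  obtain ⟨κ, hκ⟩ := exists_equivariant_map (isFreeAction_freePart (Fin 2) (Fin n → ℤ))
  let f : freePart (Fin 2) (Fin n → ℤ) → ULift.{v} (Mark × ZMod 2) := fun x =>
    ⟨if IsBoxCovered hn x.1 then patternLabel (planePattern hn x.1) 0 0
      else (.sea, ((κ x ⟨0, by omega⟩ + κ x ⟨1, by omega⟩ : ℤ) : ZMod 2))⟩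
  refine ⟨f, (isSolution_nestedBoxProblem_iff hn f).2 fun x => ?_, fun s => ?_⟩
  · have hshift : ∀ i j, (planeVec hn i j +ᵥ x).1 = shift (planeVec hn i j) x.1 := fun _ _ => rfl
    by_cases hx : IsBoxCovered hn x.1
    · have : (fun i j => (f (planeVec hn i j +ᵥ x)).down) =
          patternLabel (planePattern hn x.1) := by
        funext i j
        simp only [f, hshift, isBoxCovered_shift, if_pos hx, planePattern_shift]
        rw [patternLabel_translate, zero_add, zero_add]
      rw [this]
      exact hx.isConfiguration
    · intro i j
      simp only [f, hshift, isBoxCovered_shift, if_neg hx, hκ, Pi.add_apply, planeVec_apply_zero,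
        planeVec_apply_one]
      refine ⟨rfl, by simp, by simp, by simp, fun _ => ?_, fun _ => ?_⟩ <;> push_cast <;> ring
  · borelize ↥(freePart (Fin 2) (Fin n → ℤ))
    refine (measurableSet_patternLabel_preimage hn (ULift.up ⁻¹' s)).baireMeasurableSet.congr ?_
    rw [Filter.eventuallyEq_set]
    filter_upwards [eventually_isBoxCovered hn] with x hx
    have hfx : f x = ⟨patternLabel (planePattern hn x.1) 0 0⟩ := by simp only [f, if_pos hx]
    change _ ↔ f x ∈ s
    rw [hfx]
    exact Iff.rfl

end Solution

/-! ### The nested box problem on the triadic odometer -/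

section Odometer

/-- The translation action of `ℤⁿ` on the group of `n`-tuples of `3`-adic integers. -/
noncomputable abbrev odometerAction (n : ℕ) : AddAction (Fin n → ℤ) (ULift.{u} (Fin n → ℤ_[3])) where
  vadd γ x := ⟨fun k => (γ k : ℤ_[3]) + x.down k⟩
  zero_vadd x := by ext; simp [HVAdd.hVAdd]
  add_vadd γ δ x := by ext; simp [HVAdd.hVAdd, add_assoc]

attribute [local instance] odometerAction

variable {n : ℕ}

theorem odometer_vadd_down (γ : Fin n → ℤ) (x : ULift.{u} (Fin n → ℤ_[3])) :
    (γ +ᵥ x).down = fun k => (γ k : ℤ_[3]) + x.down k := rfl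

theorem continuous_odometer_vadd (γ : Fin n → ℤ) :
    Continuous fun x : ULift.{u} (Fin n → ℤ_[3]) => γ +ᵥ x :=
  continuous_uliftUp.comp <| continuous_pi fun k =>
    continuous_const.add ((continuous_apply k).comp continuous_uliftDown)

theorem isOpenMap_odometer_vadd (γ : Fin n → ℤ) :
    IsOpenMap fun x : ULift.{u} (Fin n → ℤ_[3]) => γ +ᵥ x :=
  IsOpenMap.of_inverse (f' := fun x => -γ +ᵥ x) (continuous_odometer_vadd _)
    (fun x => vadd_neg_vadd γ x) (fun x => neg_vadd_vadd γ x)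

theorem isBorelAction_odometer : IsBorelAction (Fin n → ℤ) (ULift.{u} (Fin n → ℤ_[3])) := by
  intro γ
  borelize (ULift.{u} (Fin n → ℤ_[3]))
  exact (continuous_odometer_vadd γ).measurable

theorem isFreeAction_odometer : IsFreeAction (Fin n → ℤ) (ULift.{u} (Fin n → ℤ_[3])) := by
  intro γ hγ x hx
  apply hγ
  funext k
  have := congrFun (congrArg ULift.down hx) k
  rw [odometer_vadd_down] at this
  simpa using this

instance polishSpace_odometer : PolishSpace (ULift.{u} (Fin n → ℤ_[3])) :=
  Topology.IsClosedEmbedding.uliftDown.polishSpace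

/-- Every point returns to each of its neighborhoods along all multiples of a power of `3`. -/
theorem exists_pow_vadd_mem {U : Set (ULift.{u} (Fin n → ℤ_[3]))} (hU : IsOpen U)
    {x : ULift.{u} (Fin n → ℤ_[3])} (hx : x ∈ U) :
    ∃ k : ℕ, ∀ z : Fin n → ℤ, ((3 : ℤ) ^ k • z) +ᵥ x ∈ U := by
  obtain ⟨ε, hε, hb⟩ := Metric.isOpen_iff.1 (hU.preimage continuous_uliftUp) x.down hx
  obtain ⟨k, hk⟩ := exists_pow_lt_of_lt_one hε (show (3⁻¹ : ℝ) < 1 by norm_num)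
  refine ⟨k, fun z => hb (?_ : ((3 : ℤ) ^ k • z +ᵥ x).down ∈ Metric.ball x.down ε)⟩
  rw [Metric.mem_ball, dist_pi_lt_iff hε]
  intro i
  rw [odometer_vadd_down, dist_eq_norm]
  simp only [Pi.smul_apply, smul_eq_mul, Int.cast_mul, Int.cast_pow, Int.cast_ofNat,
    add_sub_cancel_right]
  have h3 : ‖(3 : ℤ_[3]) ^ k‖ = (3⁻¹ : ℝ) ^ k := by
    have := PadicInt.norm_p_pow (p := 3) k
    push_cast at this
    rw [this, zpow_neg, zpow_natCast, inv_pow]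
  calc ‖(3 : ℤ_[3]) ^ k * (z i : ℤ_[3])‖ = ‖(3 : ℤ_[3]) ^ k‖ * ‖(z i : ℤ_[3])‖ := norm_mul _ _
    _ ≤ ‖(3 : ℤ_[3]) ^ k‖ * 1 := by gcongr; exact PadicInt.norm_le_one _
    _ < ε := by rw [mul_one, h3]; exact hk

theorem nestedBoxProblem_notMem_baire (hn : 2 ≤ n) :
    nestedBoxProblem.{v} hn ∉ BAIRE.{u, v, 0} (Fin n → ℤ) := by
  intro h
  obtain ⟨f, hsol, hmeas⟩ := h (ULift.{u} (Fin n → ℤ_[3])) isBorelAction_odometer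
    isFreeAction_odometer
  change ULift.{u} (Fin n → ℤ_[3]) → ULift.{v} (Mark × ZMod 2) at f
  rw [isSolution_nestedBoxProblem_iff] at hsol
  -- Each label class is open up to a meagre set. Countably many translates of these meagre sets are
  -- avoided by a generic `x`, so on its orbit labels are decided by open sets, and these are
  -- revisited along multiples of `3 ^ k`.
  choose U hUo hU using fun l : ULift.{v} (Mark × ZMod 2) => (hmeas {l}).residualEq_isOpen
  have hgen : ∀ᶠ x in residual (ULift.{u} (Fin n → ℤ_[3])), ∀ (γ : Fin n → ℤ)
      (l : ULift.{v} (Mark × ZMod 2)), f (γ +ᵥ x) = l ↔ γ +ᵥ x ∈ U l := by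
    refine eventually_countable_forall.2 fun γ => eventually_countable_forall.2 fun l => ?_
    exact (tendsto_residual_of_isOpenMap (continuous_odometer_vadd γ)
      (isOpenMap_odometer_vadd γ)).eventually (Filter.eventuallyEq_set.1 (hU l))
  obtain ⟨x, hx⟩ := (dense_of_mem_residual hgen).nonempty
  refine (hsol x).not_oddlyRecurrent fun i j => ?_
  obtain ⟨k, hk⟩ := exists_pow_vadd_mem (hUo _) ((hx (planeVec hn i j) _).1 rfl)
  refine ⟨3 ^ k, by positivity, Odd.pow (by decide), fun a b => congrArg ULift.down ?_⟩
  have := hk (planeVec hn a b)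
  rw [← add_vadd] at this
  rw [← (hx _ _).2 this]
  congr 2
  rw [planeVec_add, add_comm]
  congr 1
  simp only [planeVec, smul_add, ← Pi.single_smul, smul_eq_mul]

end Odometer

/-! ### The free part is Polish -/

/-- The diagonal map embeds the intersection into the product of the Polish spaces `s i`, with
closed range cut out by equality of coordinates. -/
theorem polishSpace_iInter_of_isOpen {X : Type u} [TopologicalSpace X] [PolishSpace X]
    {ι : Type w} [Countable ι] {s : ι → Set X} (hs : ∀ i, IsOpen (s i)) :
    PolishSpace ↥(⋂ i, s i) := by
  rcases isEmpty_or_nonempty ι with hι | ⟨⟨i₀⟩⟩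
  · rw [Set.iInter_of_empty]
    exact isClosed_univ.polishSpace
  have : ∀ i, PolishSpace (s i) := fun i => (hs i).polishSpace
  let φ : ↥(⋂ i, s i) → ∀ i, s i := fun x i => ⟨x.1, Set.mem_iInter.1 x.2 i⟩
  have hφ : Continuous φ := continuous_pi fun i => continuous_subtype_val.subtype_mk _
  have hφi : Topology.IsInducing φ := by
    refine Topology.IsInducing.of_comp hφ
      (continuous_subtype_val.comp (continuous_apply i₀) : Continuous fun z : ∀ i, s i => (z i₀).1) ?_
    exact Topology.IsInducing.subtypeVal
  refine Topology.IsClosedEmbedding.polishSpace (f := φ) ⟨⟨hφi, fun x y h => ?_⟩, ?_⟩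
  · exact Subtype.ext (congrArg (fun z : ∀ i, s i => (z i₀).1) h)
  · have : Set.range φ = ⋂ i, {z : ∀ i, s i | (z i).1 = (z i₀).1} := by
      ext z
      simp only [Set.mem_range, Set.mem_iInter, Set.mem_ofPred_eq]
      constructor
      · rintro ⟨x, rfl⟩ i
        rfl
      · intro h
        refine ⟨⟨(z i₀).1, Set.mem_iInter.2 fun i => h i ▸ (z i).2⟩, ?_⟩
        funext i
        exact Subtype.ext (h i).symm
    rw [this]
    exact isClosed_iInter fun i => isClosed_eq
      (continuous_subtype_val.comp (continuous_apply i))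
      (continuous_subtype_val.comp (continuous_apply i₀))

theorem polishSpace_freePart (X : Type u) [TopologicalSpace X] [PolishSpace X] (Γ : Type w)
    [AddGroup Γ] [Countable Γ] : PolishSpace (freePart X Γ) := by
  have h : freePart X Γ = ⋂ γ : {γ : Γ // γ ≠ 0}, {x | shift γ.1 x ≠ x} := by
    ext x
    simp [freePart]
  rw [h]
  exact polishSpace_iInter_of_isOpen fun γ => isOpen_shift_ne γ.1

/-- The lift moves the free part into the universe over which `BAIRE` quantifies; the solution is
pulled back along the homeomorphism. -/
theorem BAIRE_subset_BaireSHIFT (Γ : Type) [AddGroup Γ] [Countable Γ] :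
    BAIRE.{u, v, 0} Γ ⊆ BaireSHIFT.{v, 0} Γ := by
  intro P hP
  have := polishSpace_freePart (Fin 2) Γ
  have : PolishSpace (ULift.{u} (freePart (Fin 2) Γ)) :=
    Topology.IsClosedEmbedding.uliftDown.polishSpace
  obtain ⟨f, hf, hm⟩ := hP (ULift.{u} (freePart (Fin 2) Γ))
    (fun γ => by
      borelize (ULift.{u} (freePart (Fin 2) Γ))
      refine Continuous.measurable (continuous_uliftUp.comp ?_)
      exact ((continuous_shift γ).comp (continuous_subtype_val.comp continuous_uliftDown)).subtype_mk _)
    (fun γ hγ x hx => isFreeAction_freePart (Fin 2) Γ γ hγ x.down (congrArg ULift.down hx))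
  exact ⟨fun x => f ⟨x⟩, fun x => hf ⟨x⟩, fun s => (hm s).preimage continuous_uliftUp
    Homeomorph.ulift.symm.isOpenMap⟩

theorem theorem1p6 (n : ℕ) (hn : 2 ≤ n) :
    BAIRE.{u, v, 0} (Fin n → ℤ) ⊂ BaireSHIFT.{v, 0} (Fin n → ℤ) :=
  ⟨BAIRE_subset_BaireSHIFT _, fun h =>
    nestedBoxProblem_notMem_baire hn (h (nestedBoxProblem_mem_baireSHIFT hn))⟩
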